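/- Let $n\ge 6$, $c\in\mathbb R$, and let $\hat M$ be a smooth manifold of dimension $4m$ with a statistical structure $(\hat g,\hat\nabla,\hat\nabla^*)$: a Riemannian metric and two smooth torsion-free affine connections with $X\hat g(Y,Z)=\hat g(\hat\nabla_XY,Z)+\hat g(Y,\hat\nabla^*_XZ)$. Write $\hat\nabla^\circ=\frac12(\hat\nabla+\hat\nabla^*)$ for the Levi-Civita connection and $\hat R,\hat R^*,\hat R^\circ$ for the curvature tensors, with $R(X,Y)Z=\nabla_X\nabla_YZ-\nabla_Y\nabla_XZ-\nabla_{[X,Y]}Z$. Suppose that $\hat M$ is a quaternion Kaehler-like statistical manifold with constant $c$. This means that there is a rank-3 subbundle $\Lambda\subset\mathrm{End}(T\hat M)$ that locally has smooth canonical bases $J_1,J_2,J_3$, i.e. $J_\alpha^2=-I$ and $J_\alpha J_{\alpha+1}=-J_{\alpha+1}J_\alpha=J_{\alpha+2}$ (indices mod 3), and that for each local canonical basis there are local one-forms $\omega_\alpha$ with $$(\hat\nabla_XJ_\alpha)Y=\omega_{\alpha+2}(X)J_{\alpha+1}Y-\omega_{\alpha+1}(X)J_{\alpha+2}Y,$$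 and $$\hat R(X,Y)Z=\tfrac c4\Big\{\hat g(Y,Z)X-\hat g(X,Z)Y+\sum_{\alpha=1}^3\big[\hat g(Z,J_\alpha Y)J_\alpha X-\hat g(Z,J_\alpha X)J_\alpha Y+\hat g(X,J_\alpha Y)J_\alpha Z-\hat g(J_\alpha X,Y)J_\alpha Z\big]\Big\}.$$ Let $M$ be an immersed statistical submanifold of dimension $n$, with the induced metric $g$ and the induced connections $\nabla,\nabla^*$ and second fundamental forms $\sigma,\sigma^*$ (normal-valued) given by $\hat\nabla_XY=\nabla_XY+\sigma(X,Y)$ and $\hat\nabla^*_XY=\nabla^*_XY+\sigma^*(X,Y)$. Suppose that $M$ is Lagrangian: $J(T_pM)\perp T_pM$ for all $p\in M$ and $J\in\Lambda_p$, and $n=m$. For an orthonormal basis $e_1,\dots,e_n$ of $T_pM$ put $H=\frac1n\sum_i\sigma(e_i,e_i)$ and $H^*=\frac1n\sum_i\sigma^*(e_i,e_i)$. For a plane $\pi\subset T_pM$ with orthonormal basis $u,v$ put $$K(\pi)=\tfrac12\big[g(R(u,v)v,u)+g(R^*(u,v)v,u)-2g(R^\circ(u,v)v,u)\big],$$ $$K_\circ(\pi)=g(R^\circ(u,v)v,u),\qquad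 \hat K_\circ(\pi)=\hat g(\hat R^\circ(u,v)v,u),$$ where $R,R^*,R^\circ$ are the curvature tensors of $\nabla$, $\nabla^*$ and $\nabla^\circ=\frac12(\nabla+\nabla^*)$, and let $\tau,\tau_\circ,\hat\tau_\circ$ be the sums of $K,K_\circ,\hat K_\circ$ over the planes $\mathrm{span}(e_i,e_j)$, $1\le i<j\le n$. Suppose that $M$ attains equality in the Chen $\delta(2,2)$ inequality: at each $p\in M$ there is an orthonormal basis $e_1,\dots,e_n$ of $T_pM$ such that, with $\pi_1=\mathrm{span}(e_1,e_2)$ and $\pi_2=\mathrm{span}(e_3,e_4)$, $$(\tau-K(\pi_1)-K(\pi_2))-(\tau_\circ-K_\circ(\pi_1)-K_\circ(\pi_2))=\tfrac c8(n^2-n-4)-\tfrac{n^2(n-3)}{4(n-2)}\big(\|H\|^2+\|H^*\|^2\big)-2\big(\hat\tau_\circ-\hat K_\circ(\pi_1)-\hat K_\circ(\pi_2)\big).$$ Then $M$ is minimal: $H=H^*=0$ at every point of $M$. -/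

import Mathlib

open Set Bundle Manifold
open scoped Manifold ContDiff Topology

noncomputable section

namespace StatGeom

/-! ### Affine connections and statistical manifolds -/

section Connections

variable {E : Type*} [NormedAddCommGroup E] [NormedSpace ℝ E]
  {H : Type*} [TopologicalSpace H] (I : ModelWithCorners ℝ E H)
  (M : Type*) [TopologicalSpace M] [ChartedSpace H M]

/-- The type of (not yet lawful) differentiation rules for vector fields: `D Y x u` is read
`(∇_u Y)(x)`, with the argument order of Mathlib's `CovariantDerivative`. -/
abbrev FieldDerivation : Type _ :=
  (Π x : M, TangentSpace I x) → (Π x : M, TangentSpace I x →L[ℝ] TangentSpace I x)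

variable {I M}

/-- The curvature `R(u, v) w = ∇_U ∇_V W - ∇_V ∇_U W - ∇_[U, V] W` at `x`, where `U`, `V`, `W` are
the local vector fields that extend the tangent vectors `u`, `v`, `w` with constant components
in the preferred trivialization at `x`. For a smooth connection the value does not depend on the
choice of smooth extensions. -/
def curvature [IsManifold I 1 M] (D : FieldDerivation I M) (x : M) (u v w : TangentSpace I x) :
    TangentSpace I x :=
  let U : Π y : M, TangentSpace I y := FiberBundle.extend E u
  let V : Π y : M, TangentSpace I y := FiberBundle.extend E v
  let W : Π y : M, TangentSpace I y := FiberBundle.extend E w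
  D (fun y => D W y (V y)) x u - D (fun y => D W y (U y)) x v
    - D W x (VectorField.mlieBracket I U V x)

variable (I M)

/-- A statistical structure: a smooth Riemannian metric `g` and a pair `(∇, ∇*)` of smooth
torsion-free affine connections that are dual with respect to `g`, that is,
`X g(Y, Z) = g(∇_X Y, Z) + g(Y, ∇*_X Z)`. (The symmetry of `(∇_X g)(Y, Z)` in `X`, `Y` follows.) -/
structure StatisticalStructure [FiniteDimensional ℝ E] [CompleteSpace E] [IsManifold I ∞ M] where
  /-- the Riemannian metric -/
  g : ContMDiffRiemannianMetric I ∞ E (TangentSpace I : M → Type _)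
  /-- the connection `∇` -/
  conn : CovariantDerivative I E (TangentSpace I : M → Type _)
  /-- the dual connection `∇*` -/
  dual : CovariantDerivative I E (TangentSpace I : M → Type _)
  conn_smooth : ∀ U : Set M, IsOpen U → ContMDiffCovariantDerivativeOn E ∞ conn.toFun U
  dual_smooth : ∀ U : Set M, IsOpen U → ContMDiffCovariantDerivativeOn E ∞ dual.toFun U
  conn_torsion : conn.torsion = 0
  dual_torsion : dual.torsion = 0
  duality : ∀ (x : M) (Y Z : Π y : M, TangentSpace I y),
    MDiffAt (T% Y) x → MDiffAt (T% Z) x → ∀ u : TangentSpace I x,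
      mvfderiv I (fun y => g.inner y (Y y) (Z y)) x u
        = g.inner x (conn Y x u) (Z x) + g.inner x (Y x) (dual Z x u)

variable {I M} [FiniteDimensional ℝ E] [CompleteSpace E] [IsManifold I ∞ M]

namespace StatisticalStructure

variable (S : StatisticalStructure I M)

/-- The Levi-Civita connection `∇° = (∇ + ∇*) / 2`. -/
def leviCivita : FieldDerivation I M := fun Y x => (1 / 2 : ℝ) • (S.conn Y x + S.dual Y x)

/-- `K(u ∧ v) = ½ [g(R(u,v)v,u) + g(R*(u,v)v,u) - 2 g(R°(u,v)v,u)]`, the sectional `K`-curvature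
of the plane with orthonormal basis `u`, `v`. -/
def sectionalK (x : M) (u v : TangentSpace I x) : ℝ :=
  (1 / 2 : ℝ) * (S.g.inner x (curvature S.conn.toFun x u v v) u
    + S.g.inner x (curvature S.dual.toFun x u v v) u
    - 2 * S.g.inner x (curvature S.leviCivita x u v v) u)

/-- `K°(u ∧ v) = g(R°(u,v)v,u)`, the Riemannian sectional curvature of the plane with orthonormal
basis `u`, `v`. -/
def sectionalLC (x : M) (u v : TangentSpace I x) : ℝ :=
  S.g.inner x (curvature S.leviCivita x u v v) u

/-- `e` is an orthonormal family in the tangent space at `x`. -/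
def IsOrthonormalFrame {k : ℕ} (x : M) (e : Fin k → TangentSpace I x) : Prop :=
  ∀ i j, S.g.inner x (e i) (e j) = if i = j then 1 else 0

end StatisticalStructure

end Connections

/-- Sum of a function of pairs over all pairs `i < j`. For `K` a sectional curvature and `e` an
orthonormal frame, `sumPairs (fun i j => K (e i) (e j))` is the scalar curvature. -/
def sumPairs {k : ℕ} (K : Fin k → Fin k → ℝ) : ℝ :=
  ∑ i : Fin k, ∑ j ∈ Finset.univ.filter (fun j => i < j), K i j

/-! ### Quaternion Kaehler-like statistical manifolds -/

section Quaternion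

variable {E : Type*} [NormedAddCommGroup E] [NormedSpace ℝ E]
  {H : Type*} [TopologicalSpace H] {I : ModelWithCorners ℝ E H}
  {M : Type*} [TopologicalSpace M] [ChartedSpace H M] [IsManifold I ∞ M]

/-- `J = (J 0, J 1, J 2)` is a canonical basis of the family `Λ` of subspaces of
`End (T_x M)` over the open set `U`: the `J α` are smooth over `U`, span `Λ` and satisfy
`J_α² = -1`, `J_α J_{α+1} = -J_{α+1} J_α = J_{α+2}` (indices modulo 3). -/
structure IsCanonicalBasis (Λ : Π x : M, Submodule ℝ (TangentSpace I x →L[ℝ] TangentSpace I x))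
    (U : Set M) (J : Fin 3 → Π x : M, TangentSpace I x →L[ℝ] TangentSpace I x) : Prop where
  isOpen : IsOpen U
  smooth : ∀ α, ContMDiffOn I (I.prod 𝓘(ℝ, E →L[ℝ] E)) ∞
    (fun x => (⟨x, J α x⟩ : TotalSpace (E →L[ℝ] E)
      (fun x : M => TangentSpace I x →L[ℝ] TangentSpace I x))) U
  span : ∀ x ∈ U, Submodule.span ℝ (Set.range fun α => J α x) = Λ x
  sq : ∀ x ∈ U, ∀ α (v : TangentSpace I x), J α x (J α x v) = -v
  mul_next : ∀ x ∈ U, ∀ α (v : TangentSpace I x), J α x (J (α + 1) x v) = J (α + 2) x v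
  next_mul : ∀ x ∈ U, ∀ α (v : TangentSpace I x), J (α + 1) x (J α x v) = -J (α + 2) x v

variable [FiniteDimensional ℝ E] [CompleteSpace E]

/-- `(M, ∇, Λ, g)` is a quaternion Kaehler-like statistical manifold whose curvature is of the
quaternionic form with the real constant `c`:
* `Λ` is an almost quaternion structure, i.e. canonical bases exist locally;
* for each local canonical basis there are local one-forms `w_α` with
  `(∇_X J_α) Y = w_{α+2}(X) J_{α+1} Y - w_{α+1}(X) J_{α+2} Y`;
* the curvature `R` of `∇` is given by the quaternionic formula with constant `c`.
The metric need not be adapted to `Λ`: the tensors `J_α*` with `g(J_α X, Y) + g(X, J_α* Y) = 0` of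
an almost Hermite-like structure always exist and are determined by `J_α` and `g`. -/
structure IsQuaternionKaehlerLike (S : StatisticalStructure I M)
    (Λ : Π x : M, Submodule ℝ (TangentSpace I x →L[ℝ] TangentSpace I x)) (c : ℝ) : Prop where
  exists_basis : ∀ x : M, ∃ U J, x ∈ U ∧ IsCanonicalBasis Λ U J
  parallel : ∀ U J, IsCanonicalBasis Λ U J →
    ∃ w : Fin 3 → Π x : M, TangentSpace I x →L[ℝ] ℝ,
      ∀ x ∈ U, ∀ Y : Π y : M, TangentSpace I y, MDiffAt (T% Y) x →
        ∀ (α : Fin 3) (u : TangentSpace I x),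
          S.conn (fun y => J α y (Y y)) x u - J α x (S.conn Y x u)
            = w (α + 2) x u • J (α + 1) x (Y x) - w (α + 1) x u • J (α + 2) x (Y x)
  curvature_eq : ∀ U J, IsCanonicalBasis Λ U J → ∀ x ∈ U, ∀ X Y Z : TangentSpace I x,
    curvature S.conn.toFun x X Y Z = (c / 4) •
      (S.g.inner x Y Z • X - S.g.inner x X Z • Y
        + ∑ α, (S.g.inner x Z (J α x Y) • J α x X - S.g.inner x Z (J α x X) • J α x Y)
        + ∑ α, (S.g.inner x X (J α x Y) • J α x Z - S.g.inner x (J α x X) Y • J α x Z))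

end Quaternion

/-! ### Statistical submanifolds -/

section Submanifolds

variable {E : Type*} [NormedAddCommGroup E] [NormedSpace ℝ E]
  {H : Type*} [TopologicalSpace H] {I : ModelWithCorners ℝ E H}
  {M : Type*} [TopologicalSpace M] [ChartedSpace H M] [IsManifold I ∞ M]
  {E' : Type*} [NormedAddCommGroup E'] [NormedSpace ℝ E']
  {H' : Type*} [TopologicalSpace H'] {I' : ModelWithCorners ℝ E' H'}
  {N : Type*} [TopologicalSpace N] [ChartedSpace H' N] [IsManifold I' ∞ N]

/-- The covariant derivative `D_u W` at `p` of a vector field `W` along `f : M → N` (the pull-back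
connection). If `W = ∑ w^i (E_i ∘ f)` with the frame `E_i` of `TN` that is constant in the
preferred trivialization at `f p`, then `D_u W = ∑ dw^i(u) E_i + ∑ w^i(p) ∇_{df u} E_i`. -/
def covAlong (D : FieldDerivation I' N) (f : M → N) (W : Π q : M, TangentSpace I' (f q)) (p : M)
    (u : TangentSpace I p) : TangentSpace I' (f p) :=
  (trivializationAt E' (TangentSpace I' : N → Type _) (f p)).symm (f p)
      (mvfderiv I (fun q => (trivializationAt E' (TangentSpace I' : N → Type _) (f p)
        (⟨f q, W q⟩ : TotalSpace E' (TangentSpace I' : N → Type _))).2) p u)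
    + D (FiberBundle.extend E' (W p)) (f p) (mfderiv I I' f p u)

/-- The second fundamental form, defined by the Gauss formula
`σ(u, v) = D_u (df V) - df (∇_u V)`, where `V` extends `v` with constant components in the preferred
trivialization at `p`. -/
def secondForm (D : FieldDerivation I M) (D' : FieldDerivation I' N) (f : M → N) (p : M)
    (u v : TangentSpace I p) : TangentSpace I' (f p) :=
  let V : Π q : M, TangentSpace I q := FiberBundle.extend E v
  covAlong D' f (fun q => mfderiv I I' f q (V q)) p u - mfderiv I I' f p (D V p u)

variable [FiniteDimensional ℝ E] [CompleteSpace E] [FiniteDimensional ℝ E'] [CompleteSpace E']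

/-- `(M, g, ∇, ∇*)` is a statistical submanifold of `(N, ĝ, ∇̂, ∇̂*)` through the immersion `f`: the
structure of `M` is the one induced by `f`, that is, `g` is the pull-back of `ĝ`, and `∇_u Y`,
`∇*_u Y` are the tangential parts of the ambient derivatives of `Y` along `f`. -/
structure IsStatisticalSubmanifold (S : StatisticalStructure I M) (T : StatisticalStructure I' N)
    (f : M → N) : Prop where
  immersion : IsImmersion I I' ∞ f
  isometric : ∀ (p : M) (u v : TangentSpace I p),
    S.g.inner p u v = T.g.inner (f p) (mfderiv I I' f p u) (mfderiv I I' f p v)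
  conn_induced : ∀ (p : M) (Y : Π q : M, TangentSpace I q), MDiffAt (T% Y) p →
    ∀ u w : TangentSpace I p,
      T.g.inner (f p)
        (covAlong T.conn.toFun f (fun q => mfderiv I I' f q (Y q)) p u
          - mfderiv I I' f p (S.conn Y p u)) (mfderiv I I' f p w) = 0
  dual_induced : ∀ (p : M) (Y : Π q : M, TangentSpace I q), MDiffAt (T% Y) p →
    ∀ u w : TangentSpace I p,
      T.g.inner (f p)
        (covAlong T.dual.toFun f (fun q => mfderiv I I' f q (Y q)) p u
          - mfderiv I I' f p (S.dual Y p u)) (mfderiv I I' f p w) = 0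

variable (S : StatisticalStructure I M) (T : StatisticalStructure I' N) (f : M → N)

/-- `H = (1/n) ∑ σ(e_i, e_i)` for an orthonormal frame `e`. -/
def meanCurvature {n : ℕ} (p : M) (e : Fin n → TangentSpace I p) : TangentSpace I' (f p) :=
  (1 / n : ℝ) • ∑ i, secondForm S.conn.toFun T.conn.toFun f p (e i) (e i)

/-- `H* = (1/n) ∑ σ*(e_i, e_i)` for an orthonormal frame `e`. -/
def meanCurvatureDual {n : ℕ} (p : M) (e : Fin n → TangentSpace I p) : TangentSpace I' (f p) :=
  (1 / n : ℝ) • ∑ i, secondForm S.dual.toFun T.dual.toFun f p (e i) (e i)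

/-- Equality in the Chen `δ(2,2)` inequality for totally real statistical submanifolds of dimension
`n ≥ 4`, at the point `p`, for the planes `π₁ = span(e₁, e₂)` and `π₂ = span(e₃, e₄)` of an
orthonormal frame `e`:
`(τ - K(π₁) - K(π₂)) - (τ° - K°(π₁) - K°(π₂)) = c/8 (n² - n - 4)
  - n²(n-3)/(4(n-2)) (‖H‖² + ‖H*‖²) - 2 (τ̂° - K̂°(π₁) - K̂°(π₂))`.
Here `τ̂° = ∑_{i<j} K̂°(e_i ∧ e_j)` is the ambient Riemannian scalar curvature of the subspace
`T_p M`. -/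
def ChenEquality {n : ℕ} (hn : 4 ≤ n) (c : ℝ) (p : M) (e : Fin n → TangentSpace I p) : Prop :=
  let e₁ := e (Fin.castLE hn 0)
  let e₂ := e (Fin.castLE hn 1)
  let e₃ := e (Fin.castLE hn 2)
  let e₄ := e (Fin.castLE hn 3)
  let K := S.sectionalK p
  let K₀ := S.sectionalLC p
  let Khat₀ := fun u v : TangentSpace I p =>
    T.sectionalLC (f p) (mfderiv I I' f p u) (mfderiv I I' f p v)
  let h := meanCurvature S T f p e
  let hstar := meanCurvatureDual S T f p e
  (sumPairs (fun i j => K (e i) (e j)) - K e₁ e₂ - K e₃ e₄)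
      - (sumPairs (fun i j => K₀ (e i) (e j)) - K₀ e₁ e₂ - K₀ e₃ e₄)
    = c / 8 * ((n : ℝ) ^ 2 - n - 4)
      - (n : ℝ) ^ 2 * ((n : ℝ) - 3) / (4 * ((n : ℝ) - 2))
        * (T.g.inner (f p) h h + T.g.inner (f p) hstar hstar)
      - 2 * (sumPairs (fun i j => Khat₀ (e i) (e j)) - Khat₀ e₁ e₂ - Khat₀ e₃ e₄)

/-- `M` satisfies the equality case of the Chen `δ(2,2)` inequality: at each point equality holds
for some pair of mutually orthogonal tangent planes. -/
def SatisfiesChenEquality (n : ℕ) (hn : 4 ≤ n) (c : ℝ) : Prop :=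
  ∀ p : M, ∃ e : Fin n → TangentSpace I p,
    S.IsOrthonormalFrame p e ∧ ChenEquality S T f hn c p e

/-- `M` (of dimension `n`) is minimal with respect to both connections: `H = H* = 0`. -/
def IsMinimal (n : ℕ) : Prop :=
  ∀ (p : M) (e : Fin n → TangentSpace I p), S.IsOrthonormalFrame p e →
    meanCurvature S T f p e = 0 ∧ meanCurvatureDual S T f p e = 0

/-- `f : M → N` is totally real: `J(T_p M)` is normal to `T_p M` for each `J` in `Λ`. -/
def IsTotallyReal (T : StatisticalStructure I' N)
    (Λ : Π x : N, Submodule ℝ (TangentSpace I' x →L[ℝ] TangentSpace I' x)) (f : M → N) : Prop :=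
  ∀ (p : M), ∀ J ∈ Λ (f p), ∀ u v : TangentSpace I p,
    T.g.inner (f p) (J (mfderiv I I' f p u)) (mfderiv I I' f p v) = 0

end Submanifolds

/-- A submanifold of dimension `n` of a quaternionic manifold of dimension `4m` is Lagrangian if it
is totally real and of the maximal possible dimension `n = m`. -/
def IsLagrangian {m : ℕ} (n : ℕ)
    {N : Type*} [TopologicalSpace N] [ChartedSpace (EuclideanSpace ℝ (Fin (4 * m))) N]
    [IsManifold (𝓡 (4 * m)) ∞ N]
    {M : Type*} [TopologicalSpace M] [ChartedSpace (EuclideanSpace ℝ (Fin n)) M]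
    [IsManifold (𝓡 n) ∞ M]
    (T : StatisticalStructure (𝓡 (4 * m)) N)
    (Λ : Π x : N, Submodule ℝ (TangentSpace (𝓡 (4 * m)) x →L[ℝ] TangentSpace (𝓡 (4 * m)) x))
    (f : M → N) : Prop :=
  IsTotallyReal (I := 𝓡 n) T Λ f ∧ n = m

end StatGeom

end

/-! The equality is reduced to a statement about the two second fundamental forms at one point. In
`K - K° + 2 K̂°` the Gauss equations of `∇`, `∇*`, `∇°` enter with weights 1/2, 1/2, -2. Since `σ° =
(σ + σ*)/2`, all mixed products of `σ` and `σ*` cancel, and a plane contributes `c/4` plus half of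
`‖σ(u,v)‖² - ⟨σ(u,u), σ(v,v)⟩` plus the same for `σ*` (`IsTotallyReal.sectional_eq`). The ambient
part is `c/4` because the quaternionic terms vanish on a totally real subspace and `R̂*` is the
metric dual of `R̂`.

Let `(n-2) s = ∑ σ(e_i,e_i)`. The `n-2` vectors `σ₁₁+σ₂₂`, `σ₃₃+σ₄₄`, `σ₅₅`, ..., `σₙₙ` have mean
`s`, so the products `⟨σ_ii, σ_jj⟩` over all pairs except (1,2) and (3,4) add up to `(n-2)(n-3)/2
‖s‖²` minus half the total squared deviation from `s` (`sumPairs_trace`). The Chen equality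
therefore makes a sum of squares vanish (`chen_rigidity`): `σ_ij = 0` for `i < j`, `j ≥ 5`, and
`σ_ii = s` for `i ≥ 5`; likewise for `σ*`, with `s*`.

Differentiating `⟨J X, Y⟩ = 0` along `M`, where `∇̂ J` stays in `Λ`, gives `⟨J σ(u,v), w⟩ + ⟨J v,
σ*(u,w)⟩ = 0` (`IsTotallyReal.inner_secondForm`). For each `j` there is `i ≥ 5` with `i ≠ j`,
because `n ≥ 6`. Then `u = v = e_i`, `w = e_j` yields `⟨J s, e_j⟩ = 0`, and `u = w = e_i`, `v = e_j`
yields `⟨J e_j, s*⟩ = 0`. As the ambient dimension is `4n`, the `e_j` and `J_α e_j` form a basis,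
and the normal vectors `s`, `s*` vanish (`trace_eq_zero_of_chen_equality`).

The geometric inputs are proved for Christoffel symbols on a vector space and carried over by
charts. The Levi-Civita connection is treated as a statistical structure that is its own dual, so
one Gauss equation serves all three connections. -/

noncomputable section

namespace StatGeom

/-! ### Curvature duality, Gauss equation and shape relation in coordinates. -/

section Calculus

set_option maxSynthPendingDepth 3
set_option maxHeartbeats 800000

variable {E E' : Type*} [NormedAddCommGroup E] [NormedSpace ℝ E]
  [NormedAddCommGroup E'] [NormedSpace ℝ E']

/-- The curvature of the connection with Christoffel symbols `Γ`, where `Γ x w u` stands for the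
derivative of the constant field `w` in the direction `u`. -/
def christoffelCurvature (Γ : E → E →L[ℝ] E →L[ℝ] E) (x u v w : E) : E :=
  fderiv ℝ Γ x u w v + Γ x (Γ x w v) u - (fderiv ℝ Γ x v w u + Γ x (Γ x w u) v)

/-- The coordinate expression of the second fundamental form of `F`. -/
def chartSecondForm (Γ : E → E →L[ℝ] E →L[ℝ] E) (Γ' : E' → E' →L[ℝ] E' →L[ℝ] E') (F : E → E')
    (x v u : E) : E' :=
  fderiv ℝ (fderiv ℝ F) x u v + Γ' (F x) (fderiv ℝ F x v) (fderiv ℝ F x u)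
    - fderiv ℝ F x (Γ x v u)

/-- Differentiating the duality rule again expresses the second derivative of `G · w z`. Its
antisymmetric part in the two directions is zero; the products of a `Γ` with a `Γs` term are
symmetric and drop out, leaving the two curvature terms. -/
theorem christoffelCurvature_dual {G : E → E →L[ℝ] E →L[ℝ] ℝ} {Γ Γs : E → E →L[ℝ] E →L[ℝ] E}
    {x : E} (hG : ContDiffAt ℝ 2 G x) (hΓ : DifferentiableAt ℝ Γ x)
    (hΓs : DifferentiableAt ℝ Γs x)
    (hd : ∀ᶠ y in 𝓝 x, ∀ a b c, fderiv ℝ G y c a b = G y (Γ y a c) b + G y a (Γs y b c))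
    (u v w z : E) :
    G x (christoffelCurvature Γ x u v w) z + G x w (christoffelCurvature Γs x u v z) = 0 := by
  have hG1 : DifferentiableAt ℝ G x := hG.differentiableAt (by norm_num)
  have hG2 : DifferentiableAt ℝ (fderiv ℝ G) x :=
    (hG.fderiv_right (m := 1) (by norm_num)).differentiableAt (by norm_num)
  have hsymm : ∀ a b, fderiv ℝ (fderiv ℝ G) x a b = fderiv ℝ (fderiv ℝ G) x b a := by
    have := hG.isSymmSndFDerivAt (by simp)
    exact fun a b => this a b
  have hd0 := hd.self_of_nhds
  have key : ∀ c d, fderiv ℝ (fderiv ℝ G) x d c w z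
      = (fderiv ℝ G x d (Γ x w c) z + G x (fderiv ℝ Γ x d w c) z)
        + (fderiv ℝ G x d w (Γs x z c) + G x w (fderiv ℝ Γs x d z c)) := by
    intro c d
    have h1 : HasFDerivAt (fun y => fderiv ℝ G y c w z)
        (((((ContinuousLinearMap.apply ℝ ℝ z).comp (ContinuousLinearMap.apply ℝ _ w)).comp
          (ContinuousLinearMap.apply ℝ _ c)).comp (fderiv ℝ (fderiv ℝ G) x))) x :=
      (((ContinuousLinearMap.apply ℝ ℝ z).comp (ContinuousLinearMap.apply ℝ _ w)).comp
          (ContinuousLinearMap.apply ℝ _ c)).hasFDerivAt.comp x hG2.hasFDerivAt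
    have hA : HasFDerivAt (fun y => Γ y w c) _ x :=
      ((ContinuousLinearMap.apply ℝ E c).comp
        (ContinuousLinearMap.apply ℝ _ w)).hasFDerivAt.comp x hΓ.hasFDerivAt
    have hB : HasFDerivAt (fun y => Γs y z c) _ x :=
      ((ContinuousLinearMap.apply ℝ E c).comp
        (ContinuousLinearMap.apply ℝ _ z)).hasFDerivAt.comp x hΓs.hasFDerivAt
    have h2 := ((hG1.hasFDerivAt.clm_apply hA).clm_apply (hasFDerivAt_const z x)).add
      ((hG1.hasFDerivAt.clm_apply (hasFDerivAt_const w x)).clm_apply hB)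
    have h3 := h1.unique (h2.congr_of_eventuallyEq (hd.mono fun y hy => hy w z c))
    have h4 := congrArg (fun L => L d) h3
    simp at h4
    rw [h4]; ring
  have e1 := key v u
  have e2 := key u v
  have hs := congrArg (fun L => L w z) (hsymm u v)
  simp only [hd0] at e1 e2
  simp only [christoffelCurvature, map_add, map_sub, add_apply,
    sub_apply]
  linarith

/-- The normality `hn` is differentiated along `F`, and the derivative of `G'` is split by duality.
Antisymmetrizing in `u`, `v` removes the third derivatives of `F` and leaves the two curvatures and
products of a form with the dual form. -/
theorem gauss_equation {G : E → E →L[ℝ] E →L[ℝ] ℝ} {Γ Γs : E → E →L[ℝ] E →L[ℝ] E}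
    {G' : E' → E' →L[ℝ] E' →L[ℝ] ℝ} {Γ' Γs' : E' → E' →L[ℝ] E' →L[ℝ] E'} {F : E → E'} {x : E}
    (hF : ContDiffAt ℝ 3 F x) (hΓ : DifferentiableAt ℝ Γ x)
    (hG' : DifferentiableAt ℝ G' (F x)) (hΓ' : DifferentiableAt ℝ Γ' (F x))
    (hd : ∀ a b c, fderiv ℝ G' (F x) c a b
      = G' (F x) (Γ' (F x) a c) b + G' (F x) a (Γs' (F x) b c))
    (hiso : ∀ a b, G x a b = G' (F x) (fderiv ℝ F x a) (fderiv ℝ F x b))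
    (hn : ∀ᶠ y in 𝓝 x, ∀ a b c, G' (F y) (chartSecondForm Γ Γ' F y a b) (fderiv ℝ F y c) = 0)
    (u v w z : E) :
    G' (F x) (christoffelCurvature Γ' (F x) (fderiv ℝ F x u) (fderiv ℝ F x v) (fderiv ℝ F x w))
        (fderiv ℝ F x z)
      = G x (christoffelCurvature Γ x u v w) z
        - G' (F x) (chartSecondForm Γ Γ' F x w v) (chartSecondForm Γs Γs' F x z u)
        + G' (F x) (chartSecondForm Γ Γ' F x w u) (chartSecondForm Γs Γs' F x z v) := by
  have hF1 : HasFDerivAt F (fderiv ℝ F x) x :=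
    (hF.differentiableAt (by norm_num)).hasFDerivAt
  have hdF : ContDiffAt ℝ 2 (fderiv ℝ F) x := hF.fderiv_right (by norm_num)
  have hF2 : HasFDerivAt (fderiv ℝ F) (fderiv ℝ (fderiv ℝ F) x) x :=
    (hdF.differentiableAt (by norm_num)).hasFDerivAt
  have hF3 : HasFDerivAt (fderiv ℝ (fderiv ℝ F)) (fderiv ℝ (fderiv ℝ (fderiv ℝ F)) x) x :=
    ((hdF.fderiv_right (m := 1) (by norm_num)).differentiableAt (by norm_num)).hasFDerivAt
  have hs2 : ∀ a b, fderiv ℝ (fderiv ℝ F) x a b = fderiv ℝ (fderiv ℝ F) x b a := by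
    have := (hF.of_le (m := 2) (by norm_num)).isSymmSndFDerivAt (by simp)
    exact fun a b => this a b
  have hs3 : ∀ a b, fderiv ℝ (fderiv ℝ (fderiv ℝ F)) x a b
      = fderiv ℝ (fderiv ℝ (fderiv ℝ F)) x b a := by
    have := hdF.isSymmSndFDerivAt (by simp)
    exact fun a b => this a b
  have hΓF : HasFDerivAt (fun y => Γ' (F y)) ((fderiv ℝ Γ' (F x)).comp (fderiv ℝ F x)) x :=
    hΓ'.hasFDerivAt.comp x hF1
  have hGF : HasFDerivAt (fun y => G' (F y)) ((fderiv ℝ G' (F x)).comp (fderiv ℝ F x)) x :=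
    hG'.hasFDerivAt.comp x hF1
  -- the derivative of the second fundamental form
  let dII : E → E → E' := fun b a =>
    fderiv ℝ (fderiv ℝ (fderiv ℝ F)) x a b w
      + (fderiv ℝ Γ' (F x) (fderiv ℝ F x a) (fderiv ℝ F x w) (fderiv ℝ F x b)
        + Γ' (F x) (fderiv ℝ (fderiv ℝ F) x a w) (fderiv ℝ F x b)
        + Γ' (F x) (fderiv ℝ F x w) (fderiv ℝ (fderiv ℝ F) x a b))
      - (fderiv ℝ (fderiv ℝ F) x a (Γ x w b) + fderiv ℝ F x (fderiv ℝ Γ x a w b))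
  have key : ∀ a b,
      fderiv ℝ G' (F x) (fderiv ℝ F x a) (chartSecondForm Γ Γ' F x w b) (fderiv ℝ F x z)
        + G' (F x) (dII b a) (fderiv ℝ F x z)
        + G' (F x) (chartSecondForm Γ Γ' F x w b) (fderiv ℝ (fderiv ℝ F) x a z) = 0 := by
    intro a b
    have hA : ∀ c, HasFDerivAt (fun y => fderiv ℝ F y c) _ x := fun c =>
      hF2.clm_apply (hasFDerivAt_const c x)
    have hB : HasFDerivAt (fun y => Γ y w b) _ x :=
      (hΓ.hasFDerivAt.clm_apply (hasFDerivAt_const w x)).clm_apply (hasFDerivAt_const b x)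
    have hC : HasFDerivAt (fun y => fderiv ℝ (fderiv ℝ F) y b w) _ x :=
      (hF3.clm_apply (hasFDerivAt_const b x)).clm_apply (hasFDerivAt_const w x)
    have hII : HasFDerivAt (fun y => chartSecondForm Γ Γ' F y w b) _ x :=
      (hC.add ((hΓF.clm_apply (hA w)).clm_apply (hA b))).sub (hF2.clm_apply hB)
    have h1 := (hGF.clm_apply hII).clm_apply (hA z)
    have h2 := h1.unique ((hasFDerivAt_const (0 : ℝ) x).congr_of_eventuallyEq
      (hn.mono fun y hy => hy w b z))
    have h3 := congrArg (fun L => L a) h2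
    simp at h3
    simp only [dII, map_add, map_sub, add_apply,
      sub_apply]
    linarith
  have hn0 := hn.self_of_nhds
  have e1 := key u v
  have e2 := key v u
  rw [hd] at e1 e2
  -- Normality at the tangential corrections: `n1`, `n2` produce the iterated symbols `Γ (Γ w v) u`,
  -- and `m1`, `m2` allow the dual ambient derivative of `fderiv ℝ F x z` to be replaced by its
  -- normal part, the dual second fundamental form.
  have n1 := hn0 (Γ x w v) u z
  have n2 := hn0 (Γ x w u) v z
  have m1 : G' (F x) (chartSecondForm Γ Γ' F x w v) (fderiv ℝ F x (Γs x z u)) = 0 := by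
    rw [← hn0 w v (Γs x z u)]
  have m2 : G' (F x) (chartSecondForm Γ Γ' F x w u) (fderiv ℝ F x (Γs x z v)) = 0 := by
    rw [← hn0 w u (Γs x z v)]
  rw [hiso]
  have hs3' := congrArg (fun L => G' (F x) (L w) (fderiv ℝ F x z)) (hs3 u v)
  have hs2' := congrArg (fun L => G' (F x) (Γ' (F x) (fderiv ℝ F x w) L) (fderiv ℝ F x z))
    (hs2 u v)
  simp only [dII, chartSecondForm, christoffelCurvature, map_add, map_sub,
    add_apply, sub_apply] at e1 e2 n1 n2 m1 m2 ⊢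
  linarith

/-- The shape relation for a parallel family of endomorphisms along a totally real map. -/
theorem totallyReal_shape {Γ Γs : E → E →L[ℝ] E →L[ℝ] E}
    {G' : E' → E' →L[ℝ] E' →L[ℝ] ℝ} {Γ' Γs' : E' → E' →L[ℝ] E' →L[ℝ] E'} {F : E → E'} {x : E}
    {J : E' → E' →L[ℝ] E'} (hJ : DifferentiableAt ℝ J (F x))
    (hF : ContDiffAt ℝ 2 F x) (hG' : DifferentiableAt ℝ G' (F x))
    (hd : ∀ a b c, fderiv ℝ G' (F x) c a b
      = G' (F x) (Γ' (F x) a c) b + G' (F x) a (Γs' (F x) b c))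
    (hr : ∀ᶠ y in 𝓝 x, ∀ b c, G' (F y) (J (F y) (fderiv ℝ F y b)) (fderiv ℝ F y c) = 0)
    (hp : ∀ a b c, G' (F x) (fderiv ℝ J (F x) (fderiv ℝ F x a) (fderiv ℝ F x b)
        + Γ' (F x) (J (F x) (fderiv ℝ F x b)) (fderiv ℝ F x a)
        - J (F x) (Γ' (F x) (fderiv ℝ F x b) (fderiv ℝ F x a))) (fderiv ℝ F x c) = 0)
    (a b c : E) :
    G' (F x) (J (F x) (chartSecondForm Γ Γ' F x b a)) (fderiv ℝ F x c)
      + G' (F x) (J (F x) (fderiv ℝ F x b)) (chartSecondForm Γs Γs' F x c a) = 0 := by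
  have hF1 : HasFDerivAt F (fderiv ℝ F x) x :=
    (hF.differentiableAt (by norm_num)).hasFDerivAt
  have hF2 : HasFDerivAt (fderiv ℝ F) (fderiv ℝ (fderiv ℝ F) x) x :=
    ((hF.fderiv_right (m := 1) (by norm_num)).differentiableAt (by norm_num)).hasFDerivAt
  have hGF : HasFDerivAt (fun y => G' (F y)) ((fderiv ℝ G' (F x)).comp (fderiv ℝ F x)) x :=
    hG'.hasFDerivAt.comp x hF1
  have hJF : HasFDerivAt (fun y => J (F y)) ((fderiv ℝ J (F x)).comp (fderiv ℝ F x)) x :=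
    hJ.hasFDerivAt.comp x hF1
  have hA : ∀ c, HasFDerivAt (fun y => fderiv ℝ F y c) _ x := fun c =>
    hF2.clm_apply (hasFDerivAt_const c x)
  -- The vanishing pairing of `J (dF b)` with `dF c` is differentiated; duality turns this into
  -- covariant derivatives of both factors, and by `hp` the derivative of `J` itself is invisible to
  -- tangent vectors.
  have h1 := (hGF.clm_apply (hJF.clm_apply (hA b))).clm_apply (hA c)
  have h2 := h1.unique ((hasFDerivAt_const (0 : ℝ) x).congr_of_eventuallyEq
    (hr.mono fun y hy => hy b c))
  have h3 := congrArg (fun L => L a) h2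
  simp [hd] at h3
  have hp' := hp a b c
  -- The tangential parts subtracted in the two second fundamental forms do not contribute, since
  -- `J` of a tangent vector is normal.
  have r1 := hr.self_of_nhds (Γ x b a) c
  have r2 := hr.self_of_nhds b (Γs x c a)
  simp only [chartSecondForm, map_add, map_sub,
    add_apply, sub_apply] at hp' ⊢
  linarith

end Calculus

/-! ### Tangent vectors and coordinate fields in a chart. -/

section Charts

set_option maxSynthPendingDepth 3

variable {E : Type*} [NormedAddCommGroup E] [NormedSpace ℝ E]
  {M : Type*} [TopologicalSpace M] [ChartedSpace E M] [IsManifold 𝓘(ℝ, E) ∞ M]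

/-- The coordinates of tangent vectors at `q` in the chart at `p`. -/
def toChart (p q : M) : TangentSpace 𝓘(ℝ, E) q →L[ℝ] E :=
  (trivializationAt E (TangentSpace 𝓘(ℝ, E) : M → Type _) p).continuousLinearMapAt ℝ q

/-- The tangent vector at `q` with given coordinates in the chart at `p`. -/
def ofChart (p q : M) : E →L[ℝ] TangentSpace 𝓘(ℝ, E) q :=
  (trivializationAt E (TangentSpace 𝓘(ℝ, E) : M → Type _) p).symmL ℝ q

/-- The vector field with constant coordinates in the chart at `p`. -/
def constField (p : M) (b : E) : Π q : M, TangentSpace 𝓘(ℝ, E) q := fun q =>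
  (trivializationAt E (TangentSpace 𝓘(ℝ, E) : M → Type _) p).symm q b

/-- The coordinate expression of a function on `M` in the chart at `p`. -/
def inChart {X : Type*} (p : M) (h : M → X) : E → X := fun x => h ((chartAt E p).symm x)

theorem toChart_ofChart {p q : M} (hq : q ∈ (chartAt E p).source) (b : E) :
    toChart p q (ofChart p q b) = b :=
  (trivializationAt E (TangentSpace 𝓘(ℝ, E) : M → Type _) p).continuousLinearMapAt_symmL
    (R := ℝ) (by simpa using hq) b

theorem ofChart_toChart {p q : M} (hq : q ∈ (chartAt E p).source) (v : TangentSpace 𝓘(ℝ, E) q) :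
    ofChart p q (toChart p q v) = v :=
  (trivializationAt E (TangentSpace 𝓘(ℝ, E) : M → Type _) p).symmL_continuousLinearMapAt
    (R := ℝ) (by simpa using hq) v

theorem toChart_injective {p q : M} (hq : q ∈ (chartAt E p).source)
    {v w : TangentSpace 𝓘(ℝ, E) q} (h : toChart p q v = toChart p q w) : v = w := by
  rw [← ofChart_toChart hq v, h, ofChart_toChart hq w]

theorem trivializationAt_snd {p q : M} (hq : q ∈ (chartAt E p).source)
    (v : TangentSpace 𝓘(ℝ, E) q) :
    (trivializationAt E (TangentSpace 𝓘(ℝ, E) : M → Type _) p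
      (⟨q, v⟩ : TotalSpace E (TangentSpace 𝓘(ℝ, E) : M → Type _))).2 = toChart p q v := by
  rw [toChart, Trivialization.continuousLinearMapAt_apply, Trivialization.linearMapAt_apply,
    if_pos (by simpa using hq)]

theorem constField_apply {p q : M} (hq : q ∈ (chartAt E p).source) (b : E) :
    constField p b q = ofChart p q b := by
  rw [ofChart, Trivialization.symmL_apply _ (by simpa using hq), constField]

theorem toChart_constField {p q : M} (hq : q ∈ (chartAt E p).source) (b : E) :
    toChart p q (constField p b q) = b := by
  rw [constField_apply hq, toChart_ofChart hq]

/-- The extensions in `curvature` and `secondForm` are thus coordinate fields, which commute. -/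
theorem extend_eq_constField {p : M} (v : TangentSpace 𝓘(ℝ, E) p) :
    (FiberBundle.extend E v : Π q : M, TangentSpace 𝓘(ℝ, E) q) = constField p (toChart p p v) := by
  funext q
  rw [FiberBundle.extend, trivializationAt_snd (mem_chart_source E p), constField]

theorem toChart_eq_mfderiv {p q : M} (hq : q ∈ (chartAt E p).source)
    (v : TangentSpace 𝓘(ℝ, E) q) :
    toChart p q v = mfderiv 𝓘(ℝ, E) 𝓘(ℝ, E) (chartAt E p) q v := by
  rw [toChart, TangentBundle.continuousLinearMapAt_trivializationAt hq]
  simp [mfld_simps]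
  rfl

variable {F : Type*} [NormedAddCommGroup F] [NormedSpace ℝ F]

theorem mdifferentiableAt_chart {p q : M} (hq : q ∈ (chartAt E p).source) :
    MDifferentiableAt 𝓘(ℝ, E) 𝓘(ℝ, E) (chartAt E p) q :=
  mdifferentiableAt_atlas (chart_mem_atlas E p) hq

theorem mdifferentiableAt_chart_symm {p : M} {x : E} (hx : x ∈ (chartAt E p).target) :
    MDifferentiableAt 𝓘(ℝ, E) 𝓘(ℝ, E) (chartAt E p).symm x :=
  mdifferentiableAt_atlas_symm (chart_mem_atlas E p) hx

theorem differentiableAt_inChart {p q : M} (hq : q ∈ (chartAt E p).source) {h : M → F}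
    (hh : MDifferentiableAt 𝓘(ℝ, E) 𝓘(ℝ, F) h q) :
    DifferentiableAt ℝ (inChart p h) (chartAt E p q) := by
  rw [← mdifferentiableAt_iff_differentiableAt]
  have hx := (chartAt E p).map_source hq
  have e := (chartAt E p).left_inv hq
  rw [← e] at hh
  exact hh.comp _ (mdifferentiableAt_chart_symm hx)

theorem mvfderiv_eq_fderiv_inChart {p q : M} (hq : q ∈ (chartAt E p).source) {h : M → F}
    (hh : MDifferentiableAt 𝓘(ℝ, E) 𝓘(ℝ, F) h q) (v : TangentSpace 𝓘(ℝ, E) q) :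
    mvfderiv 𝓘(ℝ, E) h q v = fderiv ℝ (inChart p h) (chartAt E p q) (toChart p q v) := by
  have e : h =ᶠ[𝓝 q] inChart p h ∘ chartAt E p := by
    filter_upwards [(chartAt E p).open_source.mem_nhds hq] with y hy
    simp [inChart, (chartAt E p).left_inv hy]
  have h1 := (differentiableAt_inChart hq hh).mdifferentiableAt
  rw [toChart_eq_mfderiv hq]
  rw [mvfderiv, ContinuousLinearMap.comp_apply, e.mfderiv_eq, mfderiv_comp q h1
    (mdifferentiableAt_chart hq), mfderiv_eq_fderiv]
  rfl

theorem mdifferentiableAt_field_iff {p q : M} (hq : q ∈ (chartAt E p).source)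
    {Y : Π q : M, TangentSpace 𝓘(ℝ, E) q} :
    MDiffAt (T% Y) q ↔ MDifferentiableAt 𝓘(ℝ, E) 𝓘(ℝ, E) (fun q' => toChart p q' (Y q')) q := by
  rw [(trivializationAt E (TangentSpace 𝓘(ℝ, E) : M → Type _) p).mdifferentiableAt_section_iff
    𝓘(ℝ, E) Y (by simpa using hq)]
  refine Filter.EventuallyEq.mdifferentiableAt_iff ?_
  filter_upwards [(chartAt E p).open_source.mem_nhds hq] with y hy
  exact trivializationAt_snd hy _

theorem toChart_constField_eventuallyEq {p q : M} (hq : q ∈ (chartAt E p).source) (b : E) :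
    (fun q' => toChart p q' (constField p b q')) =ᶠ[𝓝 q] fun _ => b := by
  filter_upwards [(chartAt E p).open_source.mem_nhds hq] with y hy
  exact toChart_constField hy b

theorem mdifferentiableAt_constField {p q : M} (hq : q ∈ (chartAt E p).source) (b : E) :
    MDiffAt (T% (constField p b)) q := by
  rw [mdifferentiableAt_field_iff hq]
  exact mdifferentiableAt_const.congr_of_eventuallyEq (toChart_constField_eventuallyEq hq b)

theorem contMDiffOn_constField (p : M) (b : E) :
    ContMDiffOn 𝓘(ℝ, E) (𝓘(ℝ, E).prod 𝓘(ℝ, E)) ∞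
      (fun q => (⟨q, constField p b q⟩ : TotalSpace E (TangentSpace 𝓘(ℝ, E) : M → Type _)))
      (chartAt E p).source := by
  rw [(trivializationAt E (TangentSpace 𝓘(ℝ, E) : M → Type _) p).contMDiffOn_section_iff
    (chartAt E p).open_source (by simp)]
  refine (contMDiffOn_const (c := b)).congr fun q hq => ?_
  rw [trivializationAt_snd hq]
  exact toChart_constField hq b

theorem lieBracketWithin_const {V W : E → E} {x a b : E} (hV : V =ᶠ[𝓝 x] fun _ => a)
    (hW : W =ᶠ[𝓝 x] fun _ => b) : VectorField.lieBracketWithin ℝ V W univ x = 0 := by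
  rw [VectorField.lieBracketWithin_univ,
    Filter.EventuallyEq.lieBracket_vectorField_eq hV hW, VectorField.lieBracket]
  simp

/-- The manifold bracket is computed on pullbacks by the inverse chart, and there both fields are
constant near the base point. -/
theorem mlieBracket_constField [CompleteSpace E] (p : M) (a b : E) :
    VectorField.mlieBracket 𝓘(ℝ, E) (constField p a) (constField p b) p = 0 := by
  have key : ∀ c : E, (VectorField.mpullbackWithin 𝓘(ℝ, E) 𝓘(ℝ, E) (extChartAt 𝓘(ℝ, E) p).symm
      (constField p c) (range 𝓘(ℝ, E))) =ᶠ[𝓝 (extChartAt 𝓘(ℝ, E) p p)] fun _ => c := by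
    intro c
    filter_upwards [extChartAt_target_mem_nhds (I := 𝓘(ℝ, E)) p] with x hx
    have hq : (extChartAt 𝓘(ℝ, E) p).symm x ∈ (chartAt E p).source := by
      simpa [mfld_simps] using (extChartAt 𝓘(ℝ, E) p).map_target hx
    have h1 := TangentBundle.symmL_trivializationAt (I := 𝓘(ℝ, E)) hq
    rw [(extChartAt 𝓘(ℝ, E) p).right_inv hx] at h1
    rw [VectorField.mpullbackWithin_apply, ← h1]
    have h2 := ContinuousLinearMap.inverse_eq
      (f := ofChart p ((extChartAt 𝓘(ℝ, E) p).symm x)) (g := toChart p _)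
      (by ext v; exact ofChart_toChart hq v) (by ext v; exact toChart_ofChart hq v)
    exact (congrArg (fun L => L (constField p c _)) h2).trans (toChart_constField hq c)
  rw [← VectorField.mlieBracketWithin_univ, VectorField.mlieBracketWithin_apply]
  have h0 : VectorField.lieBracketWithin ℝ
      (VectorField.mpullbackWithin 𝓘(ℝ, E) 𝓘(ℝ, E) (extChartAt 𝓘(ℝ, E) p).symm
        (constField p a) (range 𝓘(ℝ, E)))
      (VectorField.mpullbackWithin 𝓘(ℝ, E) 𝓘(ℝ, E) (extChartAt 𝓘(ℝ, E) p).symm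
        (constField p b) (range 𝓘(ℝ, E)))
      ((extChartAt 𝓘(ℝ, E) p).symm ⁻¹' univ ∩ range 𝓘(ℝ, E)) (extChartAt 𝓘(ℝ, E) p p) = 0 := by
    have hu : ((extChartAt 𝓘(ℝ, E) p).symm ⁻¹' univ ∩ range 𝓘(ℝ, E)) = univ := by simp
    rw [hu]
    exact lieBracketWithin_const (key a) (key b)
  exact (congrArg _ h0).trans (map_zero _)

end Charts

/-! ### Christoffel symbols of a covariant derivative. -/

section Christoffel

set_option maxSynthPendingDepth 3

variable {E : Type*} [NormedAddCommGroup E] [NormedSpace ℝ E]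
  {M : Type*} [TopologicalSpace M] [ChartedSpace E M] [IsManifold 𝓘(ℝ, E) ∞ M]
  {F : Type*} [NormedAddCommGroup F] [NormedSpace ℝ F]
  {F' : Type*} [NormedAddCommGroup F'] [NormedSpace ℝ F']

omit [NormedSpace ℝ E] [IsManifold 𝓘(ℝ, E) ∞ M] in
theorem inChart_apply {X : Type*} {p q : M} (hq : q ∈ (chartAt E p).source) (h : M → X) :
    inChart p h (chartAt E p q) = h q := by
  rw [inChart, (chartAt E p).left_inv hq]

theorem contDiffOn_inChart {p : M} {h : M → F} {n : ℕ∞ω}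
    (hn : n ≤ ∞) (hh : ContMDiffOn 𝓘(ℝ, E) 𝓘(ℝ, F) n h (chartAt E p).source) :
    ContDiffOn ℝ n (inChart p h) (chartAt E p).target := by
  rw [← contMDiffOn_iff_contDiffOn]
  have h1 : ContMDiffOn 𝓘(ℝ, E) 𝓘(ℝ, E) n (chartAt E p).symm (chartAt E p).target :=
    (contMDiffOn_chart_symm (I := 𝓘(ℝ, E)) (n := ∞)).of_le hn
  exact hh.comp h1 fun x hx => (chartAt E p).map_target hx

omit [IsManifold 𝓘(ℝ, E) ∞ M] in
theorem mvfderiv_congr {h h' : M → F} {q : M} (e : h =ᶠ[𝓝 q] h') :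
    mvfderiv 𝓘(ℝ, E) h q = mvfderiv 𝓘(ℝ, E) h' q := by
  ext v
  exact DFunLike.congr_fun (F := TangentSpace 𝓘(ℝ, E) q →L[ℝ] F) e.mfderiv_eq v

theorem mvfderiv_clm_apply {A : M → F →L[ℝ] F'} {w : M → F} {q : M}
    (hA : MDifferentiableAt 𝓘(ℝ, E) 𝓘(ℝ, F →L[ℝ] F') A q)
    (hw : MDifferentiableAt 𝓘(ℝ, E) 𝓘(ℝ, F) w q) (u : TangentSpace 𝓘(ℝ, E) q) :
    mvfderiv 𝓘(ℝ, E) (fun q' => A q' (w q')) q u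
      = A q (mvfderiv 𝓘(ℝ, E) w q u) + mvfderiv 𝓘(ℝ, E) A q u (w q) := by
  have hq := mem_chart_source E q
  rw [mvfderiv_eq_fderiv_inChart hq (hA.clm_apply hw), mvfderiv_eq_fderiv_inChart hq hA,
    mvfderiv_eq_fderiv_inChart hq hw]
  have h1 := ((differentiableAt_inChart hq hA).hasFDerivAt.clm_apply
    (differentiableAt_inChart hq hw).hasFDerivAt).fderiv
  have h2 : inChart (E := E) q (fun q' => A q' (w q')) = fun x : E => inChart q A x (inChart q w x) := by
    funext x
    simp only [inChart]
  rw [h2, h1]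
  simp [inChart_apply hq]

/-- The derivative at `q` of the fields that are constant in the chart at `p`, as a linear map. -/
def constDeriv (D : CovariantDerivative 𝓘(ℝ, E) E (TangentSpace 𝓘(ℝ, E) : M → Type _))
    {p q : M} (hq : q ∈ (chartAt E p).source) :
    E →ₗ[ℝ] TangentSpace 𝓘(ℝ, E) q →L[ℝ] TangentSpace 𝓘(ℝ, E) q where
  toFun b := D (constField p b) q
  map_add' a b := by
    have ha := mdifferentiableAt_constField hq a
    have hb := mdifferentiableAt_constField hq b
    rw [← D.isCovariantDerivativeOnUniv.add ha hb]
    refine D.isCovariantDerivativeOnUniv.congr_of_eventuallyEq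
      (mdifferentiableAt_constField hq _) (mdifferentiableAt_add_section ha hb)
      Filter.univ_mem ?_
    filter_upwards [(chartAt E p).open_source.mem_nhds hq] with y hy
    simp [constField_apply hy]
  map_smul' c b := by
    have hb := mdifferentiableAt_constField hq b
    rw [RingHom.id_apply, ← D.isCovariantDerivativeOnUniv.smul_const c hb]
    refine D.isCovariantDerivativeOnUniv.congr_of_eventuallyEq
      (mdifferentiableAt_constField hq _) (MDifferentiableAt.smul_const_section hb)
      Filter.univ_mem ?_
    filter_upwards [(chartAt E p).open_source.mem_nhds hq] with y hy
    simp [constField_apply hy]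

variable [FiniteDimensional ℝ E]

/-- The Christoffel symbols of a connection in the chart at `p`: `christoffel D p x w u` is the
derivative in the direction `u` of the field with constant coordinates `w`. -/
def christoffel (D : FieldDerivation 𝓘(ℝ, E) M) (p : M) : E → E →L[ℝ] E →L[ℝ] E :=
  inChart p fun q => ∑ i, ((Module.finBasis ℝ E).coord i).toContinuousLinearMap.smulRight
    (toChart p q ∘L D (constField p (Module.finBasis ℝ E i)) q ∘L ofChart p q)

/-- The definition differentiates only the basis fields, which makes it bilinear by construction;
linearity of `constDeriv` extends the formula to all constant fields. -/
theorem christoffel_apply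
    (D : CovariantDerivative 𝓘(ℝ, E) E (TangentSpace 𝓘(ℝ, E) : M → Type _))
    {p q : M} (hq : q ∈ (chartAt E p).source) (b u : E) :
    christoffel D.toFun p (chartAt E p q) b u
      = toChart p q (D (constField p b) q (ofChart p q u)) := by
  have h1 : D (constField p b) q = ∑ i, (Module.finBasis ℝ E).coord i b •
      D (constField p (Module.finBasis ℝ E i)) q := by
    conv_lhs => rw [← (Module.finBasis ℝ E).sum_repr b]
    exact (map_sum (constDeriv D hq) _ _).trans
      (Finset.sum_congr rfl fun i _ => map_smul (constDeriv D hq) _ _)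
  rw [h1]
  rw [christoffel, inChart_apply hq]
  simp

/-- The coordinate formula for a connection. -/
theorem toChart_cov
    (D : CovariantDerivative 𝓘(ℝ, E) E (TangentSpace 𝓘(ℝ, E) : M → Type _))
    {p q : M} (hq : q ∈ (chartAt E p).source) {Y : Π q : M, TangentSpace 𝓘(ℝ, E) q}
    (hY : MDiffAt (T% Y) q) (v : TangentSpace 𝓘(ℝ, E) q) :
    toChart p q (D Y q v) = mvfderiv 𝓘(ℝ, E) (fun q' => toChart p q' (Y q')) q v
      + christoffel D.toFun p (chartAt E p q) (toChart p q (Y q)) (toChart p q v) := by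
  -- Covariant minus coordinate derivative is tensorial, as the Leibniz terms cancel. Its value can
  -- be read off from the constant field that agrees with `Y` at `q`, whose coordinate derivative is
  -- zero.
  let Φ : (Π q : M, TangentSpace 𝓘(ℝ, E) q) → E := fun Y =>
    toChart p q (D Y q v) - mvfderiv 𝓘(ℝ, E) (fun q' => toChart p q' (Y q')) q v
  have hΦ : TensorialAt 𝓘(ℝ, E) E Φ q := by
    constructor
    · intro f Y hf hY
      have hY' := (mdifferentiableAt_field_iff hq).1 hY
      have h1 : (fun q' => toChart p q' ((f • Y) q')) = f • fun q' => toChart p q' (Y q') := by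
        funext q'
        simp
      simp only [Φ]
      rw [h1, D.isCovariantDerivativeOnUniv.leibniz hY hf]
      have h2 := congrArg (fun L => L v) (mvfderiv_smul (I := 𝓘(ℝ, E)) hf hY')
      simp only [add_apply, smul_apply, ContinuousLinearMap.smulRight_apply, map_add,
        map_smul] at h2 ⊢
      rw [h2, smul_sub]
      abel
    · intro Y Y' hY hY'
      have h1 : (fun q' => toChart p q' ((Y + Y') q'))
          = (fun q' => toChart p q' (Y q')) + fun q' => toChart p q' (Y' q') := by
        funext q'
        simp
      simp only [Φ]
      rw [h1, D.isCovariantDerivativeOnUniv.add hY hY',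
        mvfderiv_add ((mdifferentiableAt_field_iff hq).1 hY)
          ((mdifferentiableAt_field_iff hq).1 hY')]
      simp
      abel
  have h1 := hΦ.pointwise hY (mdifferentiableAt_constField hq (toChart p q (Y q)))
    (toChart_injective hq (by rw [toChart_constField hq]))
  rw [christoffel_apply D hq, ofChart_toChart hq]
  simp only [Φ] at h1
  have h2 : mvfderiv 𝓘(ℝ, E) (fun q' => toChart p q' (constField p (toChart p q (Y q)) q')) q v
      = 0 := by
    rw [mvfderiv_congr (toChart_constField_eventuallyEq hq _), mvfderiv_const]
    simp
  rw [h2] at h1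
  rw [← sub_eq_iff_eq_add', h1, sub_zero]

end Christoffel

/-! ### Differentials of maps and covariant derivatives along maps. -/

section Along

set_option maxSynthPendingDepth 3

variable {E : Type*} [NormedAddCommGroup E] [NormedSpace ℝ E]
  {M : Type*} [TopologicalSpace M] [ChartedSpace E M] [IsManifold 𝓘(ℝ, E) ∞ M]
  {F : Type*} [NormedAddCommGroup F] [NormedSpace ℝ F]
  {E' : Type*} [NormedAddCommGroup E'] [NormedSpace ℝ E']
  {N : Type*} [TopologicalSpace N] [ChartedSpace E' N] [IsManifold 𝓘(ℝ, E') ∞ N]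

theorem trivializationAt_symm_apply {p q : M} (hq : q ∈ (chartAt E p).source) (b : E) :
    (trivializationAt E (TangentSpace 𝓘(ℝ, E) : M → Type _) p).symm q b = ofChart p q b :=
  constField_apply hq b

theorem mdifferentiableAt_of_eventuallyEq_comp_chart {p q : M} (hq : q ∈ (chartAt E p).source)
    {k : E → F} (hk : DifferentiableAt ℝ k (chartAt E p q)) {h : M → F}
    (hh : h =ᶠ[𝓝 q] k ∘ chartAt E p) : MDifferentiableAt 𝓘(ℝ, E) 𝓘(ℝ, F) h q :=
  (hk.mdifferentiableAt.comp q (mdifferentiableAt_chart hq)).congr_of_eventuallyEq hh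

theorem mvfderiv_of_eventuallyEq_comp_chart {p q : M} (hq : q ∈ (chartAt E p).source)
    {k : E → F} (hk : DifferentiableAt ℝ k (chartAt E p q)) {h : M → F}
    (hh : h =ᶠ[𝓝 q] k ∘ chartAt E p) (v : TangentSpace 𝓘(ℝ, E) q) :
    mvfderiv 𝓘(ℝ, E) h q v = fderiv ℝ k (chartAt E p q) (toChart p q v) := by
  rw [mvfderiv_eq_fderiv_inChart hq (mdifferentiableAt_of_eventuallyEq_comp_chart hq hk hh)]
  have h1 : inChart p h =ᶠ[𝓝 (chartAt E p q)] k := by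
    have hx := (chartAt E p).map_source hq
    have hc := ((chartAt E p).continuousAt_symm hx)
    rw [ContinuousAt, (chartAt E p).left_inv hq] at hc
    filter_upwards [(chartAt E p).open_target.mem_nhds hx, hc.eventually hh] with x hx hxh
    simpa [inChart, (chartAt E p).right_inv hx] using hxh
  rw [h1.fderiv_eq]

omit [IsManifold 𝓘(ℝ, E) ∞ M] [IsManifold 𝓘(ℝ, E') ∞ N] in
theorem mvfderiv_comp_map {g : N → F} {f : M → N} {q : M}
    (hg : MDifferentiableAt 𝓘(ℝ, E') 𝓘(ℝ, F) g (f q))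
    (hf : MDifferentiableAt 𝓘(ℝ, E) 𝓘(ℝ, E') f q) (u : TangentSpace 𝓘(ℝ, E) q) :
    mvfderiv 𝓘(ℝ, E) (fun q' => g (f q')) q u
      = mvfderiv 𝓘(ℝ, E') g (f q) (mfderiv 𝓘(ℝ, E) 𝓘(ℝ, E') f q u) :=
  mfderiv_comp_apply q hg hf u

/-- The coordinate expression of a map in the charts at `p` and `f p`. -/
def mapChart (f : M → N) (p : M) : E → E' := inChart p fun q => chartAt E' (f p) (f q)

theorem toChart_mfderiv {f : M → N} {p q : M} (hq : q ∈ (chartAt E p).source)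
    (hfq : f q ∈ (chartAt E' (f p)).source) (hf : MDifferentiableAt 𝓘(ℝ, E) 𝓘(ℝ, E') f q)
    (u : TangentSpace 𝓘(ℝ, E) q) :
    toChart (f p) (f q) (mfderiv 𝓘(ℝ, E) 𝓘(ℝ, E') f q u)
      = fderiv ℝ (mapChart f p) (chartAt E p q) (toChart p q u) := by
  have h1 := (mdifferentiableAt_chart hfq).comp q hf
  rw [mapChart, ← mvfderiv_eq_fderiv_inChart hq (h := fun q => chartAt E' (f p) (f q)) h1,
    toChart_eq_mfderiv hfq]
  exact (mfderiv_comp_apply q (mdifferentiableAt_chart hfq) hf u).symm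

theorem mdifferentiableAt_toChart_ofChart {p q r : M} (hp : r ∈ (chartAt E p).source)
    (hq : r ∈ (chartAt E q).source) :
    MDifferentiableAt 𝓘(ℝ, E) 𝓘(ℝ, E →L[ℝ] E) (fun y => toChart (E := E) q y ∘L ofChart p y) r := by
  have h1 := mdifferentiableAt_coordChangeL (IB := 𝓘(ℝ, E)) (F := E)
    (e := trivializationAt E (TangentSpace 𝓘(ℝ, E) : M → Type _) p)
    (e' := trivializationAt E (TangentSpace 𝓘(ℝ, E) : M → Type _) q) (x := r)
    (by simpa using hp) (by simpa using hq)
  refine h1.congr_of_eventuallyEq ?_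
  filter_upwards [(chartAt E p).open_source.mem_nhds hp,
    (chartAt E q).open_source.mem_nhds hq] with y hy hy'
  ext b
  have := Trivialization.coordChangeL_apply (R := ℝ)
    (trivializationAt E (TangentSpace 𝓘(ℝ, E) : M → Type _) p)
    (trivializationAt E (TangentSpace 𝓘(ℝ, E) : M → Type _) q) (b := y)
    ⟨by simpa using hy, by simpa using hy'⟩ b
  refine Eq.trans ?_ this.symm
  rw [trivializationAt_snd hy']
  exact congrArg _ (constField_apply hy b).symm

variable [FiniteDimensional ℝ E']

/-- The derivative along a map, in the frame given by the chart at an arbitrary point `r`. -/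
theorem covAlong_eq
    (D : CovariantDerivative 𝓘(ℝ, E') E' (TangentSpace 𝓘(ℝ, E') : N → Type _))
    {f : M → N} {q : M} {r : N} (hr : f q ∈ (chartAt E' r).source)
    (hf : MDifferentiableAt 𝓘(ℝ, E) 𝓘(ℝ, E') f q) {W : Π q : M, TangentSpace 𝓘(ℝ, E') (f q)}
    (hW : MDifferentiableAt 𝓘(ℝ, E) 𝓘(ℝ, E') (fun q' => toChart r (f q') (W q')) q)
    (u : TangentSpace 𝓘(ℝ, E) q) :
    covAlong D.toFun f W q u
      = ofChart r (f q) (mvfderiv 𝓘(ℝ, E) (fun q' => toChart r (f q') (W q')) q u)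
        + D (constField r (toChart r (f q) (W q))) (f q) (mfderiv 𝓘(ℝ, E) 𝓘(ℝ, E') f q u) := by
  have hs := mem_chart_source E' (f q)
  set w : M → E' := fun q' => toChart r (f q') (W q') with hw
  -- `covAlong` uses the frame at `f q`, which moves with `q`, while a fixed chart at `r` is wanted.
  -- The derivative of the frame change `τ` appears both in `h1` and in `h2`, so the two frames give
  -- the same result.
  set τ : N → E' →L[ℝ] E' := fun y => toChart (f q) y ∘L ofChart r y with hτ
  have hτd : MDifferentiableAt 𝓘(ℝ, E') 𝓘(ℝ, E' →L[ℝ] E') τ (f q) :=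
    mdifferentiableAt_toChart_ofChart hr hs
  have hτf : MDifferentiableAt 𝓘(ℝ, E) 𝓘(ℝ, E' →L[ℝ] E') (fun q' => τ (f q')) q := hτd.comp q hf
  have hev : (fun q' => (trivializationAt E' (TangentSpace 𝓘(ℝ, E') : N → Type _) (f q)
        (⟨f q', W q'⟩ : TotalSpace E' (TangentSpace 𝓘(ℝ, E') : N → Type _))).2)
      =ᶠ[𝓝 q] fun q' => τ (f q') (w q') := by
    filter_upwards [hf.continuousAt.eventually ((chartAt E' r).open_source.mem_nhds hr),
      hf.continuousAt.eventually ((chartAt E' (f q)).open_source.mem_nhds hs)] with y hy hy'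
    rw [trivializationAt_snd hy']
    simp [hτ, hw, ofChart_toChart hy]
  have h1 : mvfderiv 𝓘(ℝ, E) (fun q' => (trivializationAt E'
      (TangentSpace 𝓘(ℝ, E') : N → Type _) (f q)
        (⟨f q', W q'⟩ : TotalSpace E' (TangentSpace 𝓘(ℝ, E') : N → Type _))).2) q u
      = τ (f q) (mvfderiv 𝓘(ℝ, E) w q u)
        + mvfderiv 𝓘(ℝ, E) (fun q' => τ (f q')) q u (w q) := by
    rw [← mvfderiv_clm_apply hτf hW, mvfderiv_congr hev]
  have h2 : toChart (f q) (f q) (D (constField r (w q)) (f q) (mfderiv 𝓘(ℝ, E) 𝓘(ℝ, E') f q u))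
      = mvfderiv 𝓘(ℝ, E) (fun q' => τ (f q')) q u (w q)
        + toChart (f q) (f q) (D (FiberBundle.extend E' (W q)) (f q)
          (mfderiv 𝓘(ℝ, E) 𝓘(ℝ, E') f q u)) := by
    rw [toChart_cov D hs (mdifferentiableAt_constField hr _), extend_eq_constField]
    have e1 : toChart (f q) (f q) (constField r (w q) (f q)) = toChart (f q) (f q) (W q) := by
      rw [constField_apply hr, hw, ofChart_toChart hr]
    rw [e1, christoffel_apply D hs, ofChart_toChart hs]
    congr 1
    have e2 : (fun q' => toChart (f q) q' (constField r (w q) q')) =ᶠ[𝓝 (f q)]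
        fun y => τ y (w q) := by
      filter_upwards [(chartAt E' r).open_source.mem_nhds hr] with y hy
      rw [constField_apply hy]
      rfl
    rw [mvfderiv_congr e2]
    have e3 : MDifferentiableAt 𝓘(ℝ, E') 𝓘(ℝ, E') (fun y => τ y (w q)) (f q) :=
      hτd.clm_apply mdifferentiableAt_const
    have e4 := mvfderiv_comp_map e3 hf u
    rw [← e4]
    have e5 := mvfderiv_clm_apply hτf (mdifferentiableAt_const (c := w q)) u
    rw [mvfderiv_const] at e5
    simpa using e5
  apply toChart_injective hs
  rw [covAlong, map_add, map_add, h2]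
  have e1 := trivializationAt_symm_apply hs (mvfderiv 𝓘(ℝ, E) (fun q' => (trivializationAt E'
      (TangentSpace 𝓘(ℝ, E') : N → Type _) (f q)
        (⟨f q', W q'⟩ : TotalSpace E' (TangentSpace 𝓘(ℝ, E') : N → Type _))).2) q u)
  rw [e1, h1, toChart_ofChart hs]
  simp only [hτ, ContinuousLinearMap.comp_apply]
  abel

end Along

/-! ### Curvature and second fundamental form in coordinates. -/

section Coordinates

set_option maxSynthPendingDepth 3

variable {E : Type*} [NormedAddCommGroup E] [NormedSpace ℝ E] [FiniteDimensional ℝ E]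
  {M : Type*} [TopologicalSpace M] [ChartedSpace E M] [IsManifold 𝓘(ℝ, E) ∞ M]
  {F : Type*} [NormedAddCommGroup F] [NormedSpace ℝ F]
  {E' : Type*} [NormedAddCommGroup E'] [NormedSpace ℝ E'] [FiniteDimensional ℝ E']
  {N : Type*} [TopologicalSpace N] [ChartedSpace E' N] [IsManifold 𝓘(ℝ, E') ∞ N]

omit [NormedSpace ℝ E] [FiniteDimensional ℝ E] [IsManifold 𝓘(ℝ, E) ∞ M] in
theorem inChart_mem_source {p : M} {x : E} (hx : x ∈ (chartAt E p).target) :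
    (chartAt E p).symm x ∈ (chartAt E p).source := (chartAt E p).map_target hx

omit [FiniteDimensional ℝ E] in
theorem contMDiffOn_toChart {p : M} {Y : Π q : M, TangentSpace 𝓘(ℝ, E) q}
    (hY : ContMDiffOn 𝓘(ℝ, E) (𝓘(ℝ, E).prod 𝓘(ℝ, E)) ∞
      (fun q => (⟨q, Y q⟩ : TotalSpace E (TangentSpace 𝓘(ℝ, E) : M → Type _)))
      (chartAt E p).source) :
    ContMDiffOn 𝓘(ℝ, E) 𝓘(ℝ, E) ∞ (fun q => toChart p q (Y q)) (chartAt E p).source := by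
  rw [(trivializationAt E (TangentSpace 𝓘(ℝ, E) : M → Type _) p).contMDiffOn_section_iff
    (chartAt E p).open_source (by simp)] at hY
  exact hY.congr fun q hq => (trivializationAt_snd hq _).symm

theorem contDiffOn_christoffel
    (D : CovariantDerivative 𝓘(ℝ, E) E (TangentSpace 𝓘(ℝ, E) : M → Type _))
    (hD : ∀ U : Set M, IsOpen U → ContMDiffCovariantDerivativeOn E ∞ D.toFun U) (p : M) :
    ContDiffOn ℝ ∞ (christoffel D.toFun p) (chartAt E p).target := by
  rw [contDiffOn_clm_apply]
  intro b
  rw [contDiffOn_clm_apply]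
  intro a
  have h1 := (hD _ (chartAt E p).open_source).contMDiff (contMDiffOn_constField p b)
  have h2 := contDiffOn_inChart le_rfl
    (contMDiffOn_toChart (h1.clm_bundle_apply (contMDiffOn_constField p a)))
  refine h2.congr fun x hx => ?_
  have hq := inChart_mem_source hx
  have h3 := christoffel_apply D hq b a
  rw [(chartAt E p).right_inv hx] at h3
  rw [h3, inChart, constField_apply hq]

/-- On coordinate fields the bracket term is zero, so only the two iterated derivatives of `key`
remain. -/
theorem toChart_curvature [CompleteSpace E]
    (D : CovariantDerivative 𝓘(ℝ, E) E (TangentSpace 𝓘(ℝ, E) : M → Type _)) (p : M)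
    (hΓ : DifferentiableAt ℝ (christoffel D.toFun p) (chartAt E p p))
    (u v w : TangentSpace 𝓘(ℝ, E) p) :
    toChart p p (curvature D.toFun p u v w)
      = christoffelCurvature (christoffel D.toFun p) (chartAt E p p)
        (toChart p p u) (toChart p p v) (toChart p p w) := by
  have hp := mem_chart_source E p
  have key : ∀ (c d : E) (z : TangentSpace 𝓘(ℝ, E) p),
      toChart p p (D (fun y => D (constField p c) y (constField p d y)) p z)
        = fderiv ℝ (christoffel D.toFun p) (chartAt E p p) (toChart p p z) c d
          + christoffel D.toFun p (chartAt E p p)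
            (christoffel D.toFun p (chartAt E p p) c d) (toChart p p z) := by
    intro c d z
    have hd : DifferentiableAt ℝ (fun x => christoffel D.toFun p x c d) (chartAt E p p) :=
      (hΓ.clm_apply (differentiableAt_const c)).clm_apply (differentiableAt_const d)
    have hev : (fun y => toChart p y (D (constField p c) y (constField p d y)))
        =ᶠ[𝓝 p] (fun x => christoffel D.toFun p x c d) ∘ chartAt E p := by
      filter_upwards [(chartAt E p).open_source.mem_nhds hp] with y hy
      rw [Function.comp_apply, christoffel_apply D hy, constField_apply hy]
    rw [toChart_cov D hp ((mdifferentiableAt_field_iff hp).2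
      (mdifferentiableAt_of_eventuallyEq_comp_chart hp hd hev)),
      mvfderiv_of_eventuallyEq_comp_chart hp hd hev]
    have e1 := hev.self_of_nhds
    simp only [Function.comp_apply] at e1
    rw [e1]
    congr 1
    have h1 := (hΓ.hasFDerivAt.clm_apply (hasFDerivAt_const c _)).clm_apply (hasFDerivAt_const d _)
    rw [h1.fderiv]
    simp
  simp only [curvature, extend_eq_constField, mlieBracket_constField, map_zero, sub_zero, map_sub,
    key, christoffelCurvature]

omit [FiniteDimensional ℝ E] [FiniteDimensional ℝ E'] in
theorem contDiffAt_mapChart {f : M → N} (hf : ContMDiff 𝓘(ℝ, E) 𝓘(ℝ, E') ∞ f) (p : M) :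
    ContDiffAt ℝ ∞ (mapChart f p : E → E') (chartAt E p p) := by
  have hp := mem_chart_source E p
  rw [← contMDiffAt_iff_contDiffAt]
  have h1 : ContMDiffAt 𝓘(ℝ, E) 𝓘(ℝ, E) ∞ (chartAt E p).symm (chartAt E p p) :=
    (contMDiffOn_chart_symm (I := 𝓘(ℝ, E)) (n := ∞)).contMDiffAt
      ((chartAt E p).open_target.mem_nhds ((chartAt E p).map_source hp))
  have h2 : ContMDiffAt 𝓘(ℝ, E') 𝓘(ℝ, E') ∞ (chartAt E' (f p))
      (f ((chartAt E p).symm (chartAt E p p))) := by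
    rw [(chartAt E p).left_inv hp]
    exact (contMDiffOn_chart (I := 𝓘(ℝ, E')) (n := ∞)).contMDiffAt
      ((chartAt E' (f p)).open_source.mem_nhds (mem_chart_source E' (f p)))
  exact ContMDiffAt.comp (g := chartAt E' (f p)) (f := f ∘ (chartAt E p).symm) _ h2
    (hf.contMDiffAt.comp (chartAt E p p) h1)

omit [NormedSpace ℝ E] [FiniteDimensional ℝ E] [IsManifold 𝓘(ℝ, E) ∞ M] [NormedSpace ℝ E']
  [FiniteDimensional ℝ E'] [IsManifold 𝓘(ℝ, E') ∞ N] in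
theorem eventually_map_mem_source {f : M → N} (hf : Continuous f) (p : M) :
    ∀ᶠ q in 𝓝 p, q ∈ (chartAt E p).source ∧ f q ∈ (chartAt E' (f p)).source :=
  Filter.Eventually.and ((chartAt E p).open_source.mem_nhds (mem_chart_source E p))
    (hf.continuousAt.eventually ((chartAt E' (f p)).open_source.mem_nhds
      (mem_chart_source E' (f p))))

omit [NormedSpace ℝ E] [FiniteDimensional ℝ E] [IsManifold 𝓘(ℝ, E) ∞ M] in
theorem eventually_inChart {p : M} {P : M → Prop} (h : ∀ᶠ q in 𝓝 p, P q) :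
    ∀ᶠ x in 𝓝 (chartAt E p p), P ((chartAt E p).symm x) := by
  have hp := mem_chart_source E p
  have hc := (chartAt E p).continuousAt_symm ((chartAt E p).map_source hp)
  rw [ContinuousAt, (chartAt E p).left_inv hp] at hc
  exact hc.eventually h

/-- The Gauss formula in coordinates. -/
theorem eventually_toChart_covAlong_sub
    (D : CovariantDerivative 𝓘(ℝ, E) E (TangentSpace 𝓘(ℝ, E) : M → Type _))
    (D' : CovariantDerivative 𝓘(ℝ, E') E' (TangentSpace 𝓘(ℝ, E') : N → Type _))
    {f : M → N} (hf : ContMDiff 𝓘(ℝ, E) 𝓘(ℝ, E') ∞ f) (p : M) :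
    ∀ᶠ q in 𝓝 p, ∀ (v : E) (u : TangentSpace 𝓘(ℝ, E) q),
      toChart (f p) (f q) (covAlong D'.toFun f
          (fun q' => mfderiv 𝓘(ℝ, E) 𝓘(ℝ, E') f q' (constField p v q')) q u
          - mfderiv 𝓘(ℝ, E) 𝓘(ℝ, E') f q (D (constField p v) q u))
        = chartSecondForm (christoffel D.toFun p) (christoffel D'.toFun (f p)) (mapChart f p)
          (chartAt E p q) v (toChart p q u) := by
  have hfd : MDifferentiable 𝓘(ℝ, E) 𝓘(ℝ, E') f := hf.mdifferentiable (by simp)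
  have hF2 : ∀ᶠ q in 𝓝 p, DifferentiableAt ℝ (fderiv ℝ (mapChart f p : E → E')) (chartAt E p q) := by
    have h1 : ∀ᶠ x in 𝓝 (chartAt E p p), ContDiffAt ℝ 2 (mapChart f p : E → E') x :=
      ((contDiffAt_mapChart hf p).of_le (m := 2) ENat.LEInfty.out).eventually (by simp)
    have h2 := ((chartAt E p).continuousAt (mem_chart_source E p)).eventually h1
    filter_upwards [h2] with q hq
    exact (hq.fderiv_right (m := 1) (by norm_num)).differentiableAt (by norm_num)
  -- The formula is proved at all `q` near `p` with the charts at `p` and `f p` fixed, because the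
  -- Gauss equation differentiates the normality deduced from it.
  filter_upwards [(eventually_map_mem_source (E := E) (E' := E') hf.continuous
    p).eventually_nhds, hF2] with q hev hF2 v u
  obtain ⟨hq, hfq⟩ := hev.self_of_nhds
  have hd : DifferentiableAt ℝ (fun x => fderiv ℝ (mapChart f p : E → E') x v) (chartAt E p q) :=
    hF2.clm_apply (differentiableAt_const v)
  have hW : (fun q' => toChart (f p) (f q')
      (mfderiv 𝓘(ℝ, E) 𝓘(ℝ, E') f q' (constField p v q')))
      =ᶠ[𝓝 q] (fun x => fderiv ℝ (mapChart f p : E → E') x v) ∘ chartAt E p := by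
    filter_upwards [hev] with q' hq'
    rw [toChart_mfderiv hq'.1 hq'.2 (hfd q'), toChart_constField hq'.1, Function.comp_apply]
  rw [covAlong_eq D' hfq (hfd q) (mdifferentiableAt_of_eventuallyEq_comp_chart hq hd hW),
    mvfderiv_of_eventuallyEq_comp_chart hq hd hW, map_sub, map_add, toChart_ofChart hfq,
    toChart_mfderiv hq hfq (hfd q), toChart_mfderiv hq hfq (hfd q)]
  have e1 := christoffel_apply D hq v (toChart p q u)
  rw [ofChart_toChart hq] at e1
  have e2 := christoffel_apply D' hfq (fderiv ℝ (mapChart f p) (chartAt E p q) v)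
    (toChart (f p) (f q) (mfderiv 𝓘(ℝ, E) 𝓘(ℝ, E') f q u))
  rw [ofChart_toChart hfq, toChart_mfderiv hq hfq (hfd q)] at e2
  rw [← e1, toChart_constField hq]
  have e3 : chartAt E' (f p) (f q) = mapChart f p (chartAt E p q) := by
    rw [mapChart, inChart_apply hq]
  rw [chartSecondForm, ← e3, e2]
  congr 2
  rw [(hF2.hasFDerivAt.clm_apply (hasFDerivAt_const v _)).fderiv]
  simp

theorem toChart_secondForm
    (D : CovariantDerivative 𝓘(ℝ, E) E (TangentSpace 𝓘(ℝ, E) : M → Type _))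
    (D' : CovariantDerivative 𝓘(ℝ, E') E' (TangentSpace 𝓘(ℝ, E') : N → Type _))
    {f : M → N} (hf : ContMDiff 𝓘(ℝ, E) 𝓘(ℝ, E') ∞ f) (p : M) (u v : TangentSpace 𝓘(ℝ, E) p) :
    toChart (f p) (f p) (secondForm D.toFun D'.toFun f p u v)
      = chartSecondForm (christoffel D.toFun p) (christoffel D'.toFun (f p)) (mapChart f p)
          (chartAt E p p) (toChart p p v) (toChart p p u) := by
  have h1 := (eventually_toChart_covAlong_sub D D' hf p).self_of_nhds (toChart p p v) u
  rw [← h1, secondForm]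
  simp only [extend_eq_constField]

theorem christoffel_symm [CompleteSpace E]
    (D : CovariantDerivative 𝓘(ℝ, E) E (TangentSpace 𝓘(ℝ, E) : M → Type _))
    (hD : D.torsion = 0) (p : M) (a b : E) :
    christoffel D.toFun p (chartAt E p p) a b = christoffel D.toFun p (chartAt E p p) b a := by
  have hp := mem_chart_source E p
  have h1 := D.torsion_eq_zero_iff.1 hD (mdifferentiableAt_constField hp a)
    (mdifferentiableAt_constField hp b)
  rw [mlieBracket_constField, sub_eq_zero] at h1
  rw [christoffel_apply D hp, christoffel_apply D hp, ← constField_apply hp,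
    ← constField_apply hp, h1]

theorem chartSecondForm_symm [CompleteSpace E] [CompleteSpace E']
    (D : CovariantDerivative 𝓘(ℝ, E) E (TangentSpace 𝓘(ℝ, E) : M → Type _))
    (D' : CovariantDerivative 𝓘(ℝ, E') E' (TangentSpace 𝓘(ℝ, E') : N → Type _))
    (hD : D.torsion = 0) (hD' : D'.torsion = 0)
    {f : M → N} (hf : ContMDiff 𝓘(ℝ, E) 𝓘(ℝ, E') ∞ f) (p : M) (a b : E) :
    chartSecondForm (christoffel D.toFun p) (christoffel D'.toFun (f p)) (mapChart f p)
        (chartAt E p p) a b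
      = chartSecondForm (christoffel D.toFun p) (christoffel D'.toFun (f p)) (mapChart f p)
        (chartAt E p p) b a := by
  have hF := ((contDiffAt_mapChart hf p).of_le (m := 2)
    ENat.LEInfty.out).isSymmSndFDerivAt (by simp)
  have e3 : mapChart f p (chartAt E p p) = chartAt E' (f p) (f p) := by
    rw [mapChart, inChart_apply (mem_chart_source E p)]
  rw [chartSecondForm, chartSecondForm, hF b a, christoffel_symm D hD, e3, christoffel_symm D' hD']

end Coordinates

/-! ### Statistical structures in charts; dual and Levi-Civita structures. -/

section Structures

set_option maxSynthPendingDepth 3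

variable {E : Type*} [NormedAddCommGroup E] [NormedSpace ℝ E] [FiniteDimensional ℝ E]
  [CompleteSpace E]
  {M : Type*} [TopologicalSpace M] [ChartedSpace E M] [IsManifold 𝓘(ℝ, E) ∞ M]
  {E' : Type*} [NormedAddCommGroup E'] [NormedSpace ℝ E'] [FiniteDimensional ℝ E']
  [CompleteSpace E']
  {N : Type*} [TopologicalSpace N] [ChartedSpace E' N] [IsManifold 𝓘(ℝ, E') ∞ N]

namespace StatisticalStructure

variable (S : StatisticalStructure 𝓘(ℝ, E) M)

/-- The statistical structure with the two connections exchanged. -/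
def swap : StatisticalStructure 𝓘(ℝ, E) M where
  g := S.g
  conn := S.dual
  dual := S.conn
  conn_smooth := S.dual_smooth
  dual_smooth := S.conn_smooth
  conn_torsion := S.dual_torsion
  dual_torsion := S.conn_torsion
  duality x Y Z hY hZ u := by
    have h := S.duality x Z Y hZ hY u
    have e : (fun y => S.g.inner y (Y y) (Z y)) = fun y => S.g.inner y (Z y) (Y y) :=
      funext fun y => S.g.symm _ _ _
    rw [e, h, S.g.symm, S.g.symm x (Z x), add_comm]

/-- The Levi-Civita connection as a covariant derivative. -/
def leviCivitaConn : CovariantDerivative 𝓘(ℝ, E) E (TangentSpace 𝓘(ℝ, E) : M → Type _) where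
  toFun := S.leviCivita
  isCovariantDerivativeOnUniv := by
    have h := S.conn.isCovariantDerivativeOnUniv.affine_combination
      S.dual.isCovariantDerivativeOnUniv (fun _ => (1 / 2 : ℝ))
    convert h using 1
    funext Y x
    simp only [leviCivita, Pi.add_apply, Pi.smul_apply', Pi.sub_apply, Pi.one_apply]
    module

theorem leviCivitaConn_apply (Y : Π q : M, TangentSpace 𝓘(ℝ, E) q) (x : M) :
    S.leviCivitaConn Y x = (1 / 2 : ℝ) • (S.conn Y x + S.dual Y x) := rfl

theorem contMDiffCovariantDerivativeOn_leviCivita {U : Set M} (hU : IsOpen U) :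
    ContMDiffCovariantDerivativeOn E ∞ S.leviCivitaConn.toFun U := by
  have h := ContMDiffCovariantDerivativeOn.affine_combination (f := fun _ : M => (1 / 2 : ℝ))
    contMDiffOn_const (S.conn_smooth U hU) (S.dual_smooth U hU)
  convert h using 1
  funext Y x
  simp only [leviCivitaConn, leviCivita, Pi.add_apply, Pi.smul_apply', Pi.sub_apply, Pi.one_apply]
  module

theorem leviCivitaConn_torsion : S.leviCivitaConn.torsion = 0 := by
  rw [CovariantDerivative.torsion_eq_zero_iff]
  intro X Y x hX hY
  have h1 := S.conn.torsion_eq_zero_iff.1 S.conn_torsion hX hY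
  have h2 := S.dual.torsion_eq_zero_iff.1 S.dual_torsion hX hY
  simp only [leviCivitaConn_apply, smul_apply, add_apply]
  have h3 : (1 / 2 : ℝ) • (VectorField.mlieBracket 𝓘(ℝ, E) X Y x
      + VectorField.mlieBracket 𝓘(ℝ, E) X Y x) = VectorField.mlieBracket 𝓘(ℝ, E) X Y x := by
    module
  rw [← h3]
  nth_rw 1 [← h1]
  rw [← h2]
  module

/-- The statistical structure given by the Levi-Civita connection. -/
def riemannian : StatisticalStructure 𝓘(ℝ, E) M where
  g := S.g
  conn := S.leviCivitaConn
  dual := S.leviCivitaConn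
  conn_smooth _ hU := S.contMDiffCovariantDerivativeOn_leviCivita hU
  dual_smooth _ hU := S.contMDiffCovariantDerivativeOn_leviCivita hU
  conn_torsion := S.leviCivitaConn_torsion
  dual_torsion := S.leviCivitaConn_torsion
  duality x Y Z hY hZ u := by
    have h1 := S.duality x Y Z hY hZ u
    have h2 := S.swap.duality x Y Z hY hZ u
    simp only [swap] at h2
    simp only [leviCivitaConn_apply, smul_apply, add_apply, map_smul, map_add, smul_eq_mul]
    linarith

/-- The metric in the chart at `p`. -/
def metricChart (p : M) : E → E →L[ℝ] E →L[ℝ] ℝ :=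
  inChart p fun q =>
    ContinuousLinearMap.precomp ℝ (ofChart p q) ∘L S.g.inner q ∘L ofChart p q

theorem metricChart_apply {p q : M} (hq : q ∈ (chartAt E p).source) (a b : E) :
    S.metricChart p (chartAt E p q) a b = S.g.inner q (ofChart p q a) (ofChart p q b) := by
  rw [metricChart, inChart_apply hq]
  rfl

theorem metricChart_toChart {p q : M} (hq : q ∈ (chartAt E p).source)
    (u v : TangentSpace 𝓘(ℝ, E) q) :
    S.metricChart p (chartAt E p q) (toChart p q u) (toChart p q v) = S.g.inner q u v := by
  rw [metricChart_apply S hq, ofChart_toChart hq, ofChart_toChart hq]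

theorem contDiffOn_metricChart (p : M) :
    ContDiffOn ℝ ∞ (S.metricChart p) (chartAt E p).target := by
  rw [contDiffOn_clm_apply]
  intro a
  rw [contDiffOn_clm_apply]
  intro b
  have h1 : ContMDiffOn 𝓘(ℝ, E) (𝓘(ℝ, E).prod 𝓘(ℝ, ℝ)) ∞ (fun q => (⟨q, S.g.inner q
      (constField p a q) (constField p b q)⟩ : TotalSpace ℝ (Bundle.Trivial M ℝ)))
      (chartAt E p).source :=
    S.g.contMDiff.contMDiffOn.clm_bundle_apply₂ (contMDiffOn_constField p a)
      (contMDiffOn_constField p b)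
  have h2 : ContMDiffOn 𝓘(ℝ, E) 𝓘(ℝ, ℝ) ∞ (fun q => S.g.inner q
      (constField p a q) (constField p b q)) (chartAt E p).source := fun q hq => by
    have := h1 q hq
    rw [contMDiffWithinAt_totalSpace] at this
    exact this.2
  refine (contDiffOn_inChart le_rfl h2).congr fun x hx => ?_
  have hq := inChart_mem_source hx
  have h3 := S.metricChart_apply hq a b
  rw [(chartAt E p).right_inv hx] at h3
  rw [h3, inChart, constField_apply hq, constField_apply hq]

theorem contDiffAt_metricChart (p : M) :
    ContDiffAt ℝ ∞ (S.metricChart p) (chartAt E p p) :=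
  (S.contDiffOn_metricChart p).contDiffAt
    ((chartAt E p).open_target.mem_nhds ((chartAt E p).map_source (mem_chart_source E p)))

theorem differentiableAt_christoffel_conn (p : M) :
    DifferentiableAt ℝ (christoffel S.conn.toFun p) (chartAt E p p) :=
  ((contDiffOn_christoffel S.conn S.conn_smooth p).contDiffAt
    ((chartAt E p).open_target.mem_nhds
      ((chartAt E p).map_source (mem_chart_source E p)))).differentiableAt (by simp)

/-- This is the duality axiom on two coordinate fields. It is stated over the whole chart because
curvature duality differentiates it. -/
theorem fderiv_metricChart {p : M} {x : E} (hx : x ∈ (chartAt E p).target) (a b c : E) :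
    fderiv ℝ (S.metricChart p) x c a b
      = S.metricChart p x (christoffel S.conn.toFun p x a c) b
        + S.metricChart p x a (christoffel S.dual.toFun p x b c) := by
  have hq := inChart_mem_source hx
  have hx' := (chartAt E p).right_inv hx
  set q := (chartAt E p).symm x with hqx
  have hG : DifferentiableAt ℝ (S.metricChart p) (chartAt E p q) := by
    rw [hx']
    exact ((S.contDiffOn_metricChart p).contDiffAt
      ((chartAt E p).open_target.mem_nhds hx)).differentiableAt (by simp)
  have hd : DifferentiableAt ℝ (fun x => S.metricChart p x a b) (chartAt E p q) :=
    (hG.clm_apply (differentiableAt_const a)).clm_apply (differentiableAt_const b)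
  have hev : (fun y => S.g.inner y (constField p a y) (constField p b y))
      =ᶠ[𝓝 q] (fun x => S.metricChart p x a b) ∘ chartAt E p := by
    filter_upwards [(chartAt E p).open_source.mem_nhds hq] with y hy
    rw [Function.comp_apply, S.metricChart_apply hy, constField_apply hy, constField_apply hy]
  have h1 := S.duality q _ _ (mdifferentiableAt_constField hq a)
    (mdifferentiableAt_constField hq b) (ofChart p q c)
  rw [mvfderiv_of_eventuallyEq_comp_chart hq hd hev, toChart_ofChart hq,
    ((hG.hasFDerivAt.clm_apply (hasFDerivAt_const a _)).clm_apply
      (hasFDerivAt_const b _)).fderiv] at h1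
  rw [← hx', christoffel_apply S.conn hq, christoffel_apply S.dual hq, S.metricChart_apply hq,
    S.metricChart_apply hq, ofChart_toChart hq, ofChart_toChart hq, ← constField_apply hq a,
    ← constField_apply hq b, ← h1]
  simp

/-- The curvature tensors of dual connections are dual to each other. -/
theorem inner_curvature_dual (p : M) (u v w z : TangentSpace 𝓘(ℝ, E) p) :
    S.g.inner p (curvature S.conn.toFun p u v w) z
      + S.g.inner p w (curvature S.dual.toFun p u v z) = 0 := by
  have hp := mem_chart_source E p
  rw [← S.metricChart_toChart hp, ← S.metricChart_toChart hp,
    toChart_curvature S.conn p (S.differentiableAt_christoffel_conn p),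
    toChart_curvature S.dual p (S.swap.differentiableAt_christoffel_conn p)]
  refine christoffelCurvature_dual ((S.contDiffAt_metricChart p).of_le ENat.LEInfty.out)
    (S.differentiableAt_christoffel_conn p) (S.swap.differentiableAt_christoffel_conn p) ?_ _ _ _ _
  filter_upwards [(chartAt E p).open_target.mem_nhds ((chartAt E p).map_source hp)] with x hx
  exact S.fderiv_metricChart hx

end StatisticalStructure

end Structures

/-! ### Gauss equation and totally real relation for statistical submanifolds. -/

section Submanifold

set_option maxSynthPendingDepth 3

variable {E : Type*} [NormedAddCommGroup E] [NormedSpace ℝ E] [FiniteDimensional ℝ E]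
  [CompleteSpace E]
  {M : Type*} [TopologicalSpace M] [ChartedSpace E M] [IsManifold 𝓘(ℝ, E) ∞ M]
  {E' : Type*} [NormedAddCommGroup E'] [NormedSpace ℝ E'] [FiniteDimensional ℝ E']
  [CompleteSpace E']
  {N : Type*} [TopologicalSpace N] [ChartedSpace E' N] [IsManifold 𝓘(ℝ, E') ∞ N]
  {S : StatisticalStructure 𝓘(ℝ, E) M} {T : StatisticalStructure 𝓘(ℝ, E') N} {f : M → N}

omit [FiniteDimensional ℝ E] [CompleteSpace E] [IsManifold 𝓘(ℝ, E) ∞ M] in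
theorem covAlong_leviCivita (T : StatisticalStructure 𝓘(ℝ, E') N) (f : M → N)
    (W : Π q : M, TangentSpace 𝓘(ℝ, E') (f q)) (p : M) (u : TangentSpace 𝓘(ℝ, E) p) :
    covAlong T.leviCivita f W p u
      = (1 / 2 : ℝ) • (covAlong T.conn.toFun f W p u + covAlong T.dual.toFun f W p u) := by
  simp only [covAlong, StatisticalStructure.leviCivita, smul_apply, add_apply]
  module

/-- The Gauss formula is affine in the pair of connections. This averaging is what later cancels the
mixed products of `σ` and `σ*`. -/
theorem secondForm_leviCivita (S : StatisticalStructure 𝓘(ℝ, E) M)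
    (T : StatisticalStructure 𝓘(ℝ, E') N) (f : M → N) (p : M) (u v : TangentSpace 𝓘(ℝ, E) p) :
    secondForm S.leviCivita T.leviCivita f p u v
      = (1 / 2 : ℝ) • (secondForm S.conn.toFun T.conn.toFun f p u v
        + secondForm S.dual.toFun T.dual.toFun f p u v) := by
  simp only [secondForm, covAlong_leviCivita, StatisticalStructure.leviCivita, smul_apply,
    add_apply, map_smul, map_add]
  module

namespace IsStatisticalSubmanifold

theorem swap (hf : IsStatisticalSubmanifold S T f) : IsStatisticalSubmanifold S.swap T.swap f where
  immersion := hf.immersion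
  isometric := hf.isometric
  conn_induced := hf.dual_induced
  dual_induced := hf.conn_induced

theorem riemannian (hf : IsStatisticalSubmanifold S T f) :
    IsStatisticalSubmanifold S.riemannian T.riemannian f := by
  have key : ∀ (p : M) (Y : Π q : M, TangentSpace 𝓘(ℝ, E) q), MDiffAt (T% Y) p →
      ∀ u w : TangentSpace 𝓘(ℝ, E) p, T.g.inner (f p)
        (covAlong T.leviCivita f (fun q => mfderiv 𝓘(ℝ, E) 𝓘(ℝ, E') f q (Y q)) p u
          - mfderiv 𝓘(ℝ, E) 𝓘(ℝ, E') f p (S.leviCivita Y p u))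
        (mfderiv 𝓘(ℝ, E) 𝓘(ℝ, E') f p w) = 0 := by
    intro p Y hY u w
    have h1 := hf.conn_induced p Y hY u w
    have h2 := hf.dual_induced p Y hY u w
    simp only [covAlong_leviCivita, StatisticalStructure.leviCivita, smul_apply, add_apply,
      map_smul, map_add, map_sub, sub_apply, smul_eq_mul] at h1 h2 ⊢
    linarith
  exact ⟨hf.immersion, hf.isometric, key, key⟩

theorem contMDiff (hf : IsStatisticalSubmanifold S T f) : ContMDiff 𝓘(ℝ, E) 𝓘(ℝ, E') ∞ f :=
  hf.immersion.contMDiff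

theorem inner_secondForm_tangent (hf : IsStatisticalSubmanifold S T f) (p : M)
    (u v w : TangentSpace 𝓘(ℝ, E) p) :
    T.g.inner (f p) (secondForm S.conn.toFun T.conn.toFun f p u v)
      (mfderiv 𝓘(ℝ, E) 𝓘(ℝ, E') f p w) = 0 := by
  rw [secondForm, extend_eq_constField]
  exact hf.conn_induced p _ (mdifferentiableAt_constField (mem_chart_source E p) _) u w

theorem secondForm_symm (hf : IsStatisticalSubmanifold S T f) (p : M)
    (u v : TangentSpace 𝓘(ℝ, E) p) :
    secondForm S.conn.toFun T.conn.toFun f p u v = secondForm S.conn.toFun T.conn.toFun f p v u := by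
  refine toChart_injective (mem_chart_source E' (f p)) ?_
  rw [toChart_secondForm S.conn T.conn hf.contMDiff, toChart_secondForm S.conn T.conn hf.contMDiff,
    chartSecondForm_symm S.conn T.conn S.conn_torsion T.conn_torsion hf.contMDiff]

theorem metricChart_eq (hf : IsStatisticalSubmanifold S T f) {p q : M}
    (hq : q ∈ (chartAt E p).source) (hfq : f q ∈ (chartAt E' (f p)).source) (a b : E) :
    S.metricChart p (chartAt E p q) a b = T.metricChart (f p) (mapChart f p (chartAt E p q))
      (fderiv ℝ (mapChart f p) (chartAt E p q) a) (fderiv ℝ (mapChart f p) (chartAt E p q) b) := by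
  have hfd : MDifferentiable 𝓘(ℝ, E) 𝓘(ℝ, E') f := hf.contMDiff.mdifferentiable (by simp)
  have e := toChart_mfderiv (E' := E') hq hfq (hfd q)
  rw [S.metricChart_apply hq, hf.isometric, ← T.metricChart_toChart hfq, e, e,
    toChart_ofChart hq, toChart_ofChart hq, mapChart, inChart_apply hq]

/-- Normality on a neighbourhood, in the form that `gauss_equation` differentiates. -/
theorem eventually_metricChart_chartSecondForm (hf : IsStatisticalSubmanifold S T f) (p : M) :
    ∀ᶠ x in 𝓝 (chartAt E p p), ∀ a b c, T.metricChart (f p) (mapChart f p x)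
      (chartSecondForm (christoffel S.conn.toFun p) (christoffel T.conn.toFun (f p))
        (mapChart f p) x a b) (fderiv ℝ (mapChart f p) x c) = 0 := by
  have hfd : MDifferentiable 𝓘(ℝ, E) 𝓘(ℝ, E') f := hf.contMDiff.mdifferentiable (by simp)
  filter_upwards [eventually_inChart (eventually_toChart_covAlong_sub S.conn T.conn hf.contMDiff p),
    eventually_inChart (eventually_map_mem_source (E := E) (E' := E') hf.contMDiff.continuous p),
    (chartAt E p).open_target.mem_nhds ((chartAt E p).map_source (mem_chart_source E p))]
    with x h1 h2 hx a b c
  obtain ⟨hq, hfq⟩ := h2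
  have h3 := h1 a (ofChart p _ b)
  have h4 := toChart_mfderiv (E' := E') hq hfq (hfd _) (ofChart p _ c)
  have h5 := hf.conn_induced _ _ (mdifferentiableAt_constField hq a) (ofChart p _ b)
    (ofChart p _ c)
  rw [← T.metricChart_toChart hfq, h3, h4] at h5
  rw [toChart_ofChart hq, toChart_ofChart hq, (chartAt E p).right_inv hx] at h5
  exact h5

/-- The Gauss equation. -/
theorem gauss (hf : IsStatisticalSubmanifold S T f) (p : M)
    (u v w z : TangentSpace 𝓘(ℝ, E) p) :
    S.g.inner p (curvature S.conn.toFun p u v w) z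
      = T.g.inner (f p) (curvature T.conn.toFun (f p) (mfderiv 𝓘(ℝ, E) 𝓘(ℝ, E') f p u)
          (mfderiv 𝓘(ℝ, E) 𝓘(ℝ, E') f p v) (mfderiv 𝓘(ℝ, E) 𝓘(ℝ, E') f p w))
          (mfderiv 𝓘(ℝ, E) 𝓘(ℝ, E') f p z)
        + T.g.inner (f p) (secondForm S.conn.toFun T.conn.toFun f p v w)
          (secondForm S.dual.toFun T.dual.toFun f p u z)
        - T.g.inner (f p) (secondForm S.conn.toFun T.conn.toFun f p u w)
          (secondForm S.dual.toFun T.dual.toFun f p v z) := by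
  have hp := mem_chart_source E p
  have hfp := mem_chart_source E' (f p)
  have hF : mapChart f p (chartAt E p p) = chartAt E' (f p) (f p) := by
    rw [mapChart, inChart_apply hp]
  have hfd : MDifferentiable 𝓘(ℝ, E) 𝓘(ℝ, E') f := hf.contMDiff.mdifferentiable (by simp)
  have e := toChart_mfderiv (E' := E') hp hfp (hfd p)
  have key := gauss_equation (G := S.metricChart p) (G' := T.metricChart (f p))
    (Γ := christoffel S.conn.toFun p) (Γs := christoffel S.dual.toFun p)
    (Γ' := christoffel T.conn.toFun (f p)) (Γs' := christoffel T.dual.toFun (f p))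
    (F := mapChart f p) (x := chartAt E p p)
    ((contDiffAt_mapChart hf.contMDiff p).of_le ENat.LEInfty.out)
    (S.differentiableAt_christoffel_conn p)
    (by rw [hF]; exact (T.contDiffAt_metricChart (f p)).differentiableAt (by simp))
    (by rw [hF]; exact T.differentiableAt_christoffel_conn (f p))
    (by rw [hF]; exact T.fderiv_metricChart ((chartAt E' (f p)).map_source hfp))
    (hf.metricChart_eq hp hfp) (hf.eventually_metricChart_chartSecondForm p)
    (toChart p p u) (toChart p p v) (toChart p p w) (toChart p p z)
  rw [← toChart_secondForm S.conn T.conn hf.contMDiff,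
    ← toChart_secondForm S.conn T.conn hf.contMDiff,
    ← toChart_secondForm S.dual T.dual hf.contMDiff,
    ← toChart_secondForm S.dual T.dual hf.contMDiff, hF, ← e, ← e, ← e, ← e,
    ← toChart_curvature T.conn (f p) (T.differentiableAt_christoffel_conn (f p)),
    ← toChart_curvature S.conn p (S.differentiableAt_christoffel_conn p),
    T.metricChart_toChart hfp, T.metricChart_toChart hfp, T.metricChart_toChart hfp,
    S.metricChart_toChart hp] at key
  linarith

end IsStatisticalSubmanifold

/-- A family of endomorphisms of the tangent spaces in the chart at `r`. -/
def endChart (r : N) (J : Π x : N, TangentSpace 𝓘(ℝ, E') x →L[ℝ] TangentSpace 𝓘(ℝ, E') x) :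
    E' → E' →L[ℝ] E' :=
  inChart r fun y => toChart r y ∘L J y ∘L ofChart r y

omit [FiniteDimensional ℝ E'] [CompleteSpace E'] in
theorem endChart_apply {r y : N} (hy : y ∈ (chartAt E' r).source)
    (J : Π x : N, TangentSpace 𝓘(ℝ, E') x →L[ℝ] TangentSpace 𝓘(ℝ, E') x)
    (v : TangentSpace 𝓘(ℝ, E') y) :
    endChart r J (chartAt E' r y) (toChart r y v) = toChart r y (J y v) := by
  rw [endChart, inChart_apply hy]
  simp [ofChart_toChart hy]

omit [FiniteDimensional ℝ E'] [CompleteSpace E'] in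
theorem differentiableAt_endChart {r : N}
    {J : Π x : N, TangentSpace 𝓘(ℝ, E') x →L[ℝ] TangentSpace 𝓘(ℝ, E') x}
    (hJ : ContMDiffAt 𝓘(ℝ, E') (𝓘(ℝ, E').prod 𝓘(ℝ, E' →L[ℝ] E')) ∞
      (fun x => (⟨x, J x⟩ : TotalSpace (E' →L[ℝ] E')
      (fun x : N => TangentSpace 𝓘(ℝ, E') x →L[ℝ] TangentSpace 𝓘(ℝ, E') x))) r) :
    DifferentiableAt ℝ (endChart r J) (chartAt E' r r) := by
  rw [contMDiffAt_hom_bundle] at hJ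
  exact differentiableAt_inChart (mem_chart_source E' r) (hJ.2.mdifferentiableAt (by simp))

omit [CompleteSpace E'] in
theorem fderiv_endChart
    (D : CovariantDerivative 𝓘(ℝ, E') E' (TangentSpace 𝓘(ℝ, E') : N → Type _)) {r : N}
    {J : Π x : N, TangentSpace 𝓘(ℝ, E') x →L[ℝ] TangentSpace 𝓘(ℝ, E') x}
    (hJ : DifferentiableAt ℝ (endChart r J) (chartAt E' r r)) (b : E')
    (u : TangentSpace 𝓘(ℝ, E') r) :
    fderiv ℝ (endChart r J) (chartAt E' r r) (toChart r r u) b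
        + christoffel D.toFun r (chartAt E' r r) (endChart r J (chartAt E' r r) b) (toChart r r u)
        - endChart r J (chartAt E' r r)
          (christoffel D.toFun r (chartAt E' r r) b (toChart r r u))
      = toChart r r (D (fun y => J y (constField r b y)) r u - J r (D (constField r b) r u)) := by
  have hr := mem_chart_source E' r
  have hev : (fun y => toChart r y (J y (constField r b y)))
      =ᶠ[𝓝 r] (fun x => endChart r J x b) ∘ chartAt E' r := by
    filter_upwards [(chartAt E' r).open_source.mem_nhds hr] with y hy
    rw [Function.comp_apply, ← endChart_apply hy, toChart_constField hy]
  have hd : DifferentiableAt ℝ (fun x => endChart r J x b) (chartAt E' r r) :=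
    hJ.clm_apply (differentiableAt_const b)
  have h1 := christoffel_apply D hr b (toChart r r u)
  rw [ofChart_toChart hr] at h1
  rw [map_sub, toChart_cov D hr ((mdifferentiableAt_field_iff hr).2
      (mdifferentiableAt_of_eventuallyEq_comp_chart hr hd hev)),
      mvfderiv_of_eventuallyEq_comp_chart hr hd hev, ← endChart_apply hr,
      (hJ.hasFDerivAt.clm_apply (hasFDerivAt_const b _)).fderiv, h1,
      endChart_apply hr J (D (constField r b) r u), toChart_constField hr]
  simp

/-- The relation between the two second fundamental forms of a totally real submanifold. -/
theorem IsTotallyReal.inner_secondForm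
    {Λ : Π x : N, Submodule ℝ (TangentSpace 𝓘(ℝ, E') x →L[ℝ] TangentSpace 𝓘(ℝ, E') x)} {c : ℝ}
    (hr : IsTotallyReal (I := 𝓘(ℝ, E)) T Λ f) (hN : IsQuaternionKaehlerLike T Λ c)
    (hf : IsStatisticalSubmanifold S T f) {U : Set N}
    {J : Fin 3 → Π x : N, TangentSpace 𝓘(ℝ, E') x →L[ℝ] TangentSpace 𝓘(ℝ, E') x}
    (hJ : IsCanonicalBasis Λ U J) {p : M} (hp : f p ∈ U) (α : Fin 3)
    (u v w : TangentSpace 𝓘(ℝ, E) p) :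
    T.g.inner (f p) (J α (f p) (secondForm S.conn.toFun T.conn.toFun f p u v))
        (mfderiv 𝓘(ℝ, E) 𝓘(ℝ, E') f p w)
      + T.g.inner (f p) (J α (f p) (mfderiv 𝓘(ℝ, E) 𝓘(ℝ, E') f p v))
        (secondForm S.dual.toFun T.dual.toFun f p u w) = 0 := by
  have hps := mem_chart_source E p
  have hfp := mem_chart_source E' (f p)
  have hF : mapChart f p (chartAt E p p) = chartAt E' (f p) (f p) := by
    rw [mapChart, inChart_apply hps]
  have hfd : MDifferentiable 𝓘(ℝ, E) 𝓘(ℝ, E') f := hf.contMDiff.mdifferentiable (by simp)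
  have e := toChart_mfderiv (E' := E') hps hfp (hfd p)
  have hmem : ∀ β, ∀ y ∈ U, J β y ∈ Λ y := fun β y hy => by
    rw [← hJ.span y hy]
    exact Submodule.subset_span ⟨β, rfl⟩
  have hJd : DifferentiableAt ℝ (endChart (f p) (J α)) (chartAt E' (f p) (f p)) :=
    differentiableAt_endChart ((hJ.smooth α).contMDiffAt (hJ.isOpen.mem_nhds hp))
  have key := totallyReal_shape (G' := T.metricChart (f p))
    (Γ := christoffel S.conn.toFun p) (Γs := christoffel S.dual.toFun p)
    (Γ' := christoffel T.conn.toFun (f p)) (Γs' := christoffel T.dual.toFun (f p))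
    (F := mapChart f p) (x := chartAt E p p) (J := endChart (f p) (J α))
    (by rw [hF]; exact hJd)
    ((contDiffAt_mapChart hf.contMDiff p).of_le ENat.LEInfty.out)
    (by rw [hF]; exact (T.contDiffAt_metricChart (f p)).differentiableAt (by simp))
    (by rw [hF]; exact T.fderiv_metricChart ((chartAt E' (f p)).map_source hfp))
    (by
      filter_upwards [eventually_inChart (eventually_map_mem_source (E := E) (E' := E')
          hf.contMDiff.continuous p),
        eventually_inChart (hf.contMDiff.continuous.continuousAt.eventually
          (hJ.isOpen.mem_nhds hp)),
        (chartAt E p).open_target.mem_nhds ((chartAt E p).map_source hps)] with x h2 hU hx b c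
      obtain ⟨hq, hfq⟩ := h2
      have h3 := hr _ _ (hmem α _ hU) (ofChart p _ b) (ofChart p _ c)
      have e' := toChart_mfderiv (E' := E') hq hfq (hfd _)
      rw [← T.metricChart_toChart hfq, ← endChart_apply hfq, e', e', toChart_ofChart hq,
        toChart_ofChart hq, (chartAt E p).right_inv hx] at h3
      exact h3)
    (by
      intro a b c
      -- The derivative of `J α` is a combination of the other two members of the canonical basis,
      -- both of which send tangent vectors to normal ones.
      obtain ⟨w, hw⟩ := hN.parallel U J hJ
      have e1 := e (ofChart p p a)
      have e2 := e (ofChart p p b)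
      have e3 := e (ofChart p p c)
      rw [toChart_ofChart hps] at e1 e2 e3
      rw [hF, ← e1, fderiv_endChart T.conn hJd, ← e3, T.metricChart_toChart hfp,
        hw _ hp _ (mdifferentiableAt_constField hfp _), ← e2, constField_apply hfp,
        ofChart_toChart hfp]
      simp only [map_sub, map_smul, sub_apply, smul_apply, hr _ _ (hmem _ _ hp), smul_zero,
        sub_zero])
    (toChart p p u) (toChart p p v) (toChart p p w)
  rw [← toChart_secondForm S.conn T.conn hf.contMDiff,
    ← toChart_secondForm S.dual T.dual hf.contMDiff, hF, ← e, ← e, endChart_apply hfp,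
    endChart_apply hfp, T.metricChart_toChart hfp, T.metricChart_toChart hfp] at key
  exact key

end Submanifold

/-! ### Linear algebra of the Chen inequality. -/

section Algebra

variable {V : Type*} [AddCommGroup V] [Module ℝ V] {n : ℕ}

theorem sumPairs_eq_sum_filter (K : Fin n → Fin n → ℝ) :
    sumPairs K = ∑ x ∈ (Finset.univ : Finset (Fin n × Fin n)).filter (fun x => x.1 < x.2),
      K x.1 x.2 := by
  rw [sumPairs, Finset.sum_filter, Fintype.sum_prod_type]
  simp only [Finset.sum_filter]

theorem sumPairs_congr {K L : Fin n → Fin n → ℝ} (h : ∀ i j, i < j → K i j = L i j) :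
    sumPairs K = sumPairs L := by
  rw [sumPairs_eq_sum_filter, sumPairs_eq_sum_filter]
  exact Finset.sum_congr rfl fun x hx => h _ _ (Finset.mem_filter.1 hx).2

theorem sumPairs_add (K L : Fin n → Fin n → ℝ) :
    sumPairs (fun i j => K i j + L i j) = sumPairs K + sumPairs L := by
  simp only [sumPairs_eq_sum_filter, Finset.sum_add_distrib]

theorem sumPairs_mul (c : ℝ) (K : Fin n → Fin n → ℝ) :
    sumPairs (fun i j => c * K i j) = c * sumPairs K := by
  simp only [sumPairs_eq_sum_filter, Finset.mul_sum]

theorem two_mul_sumPairs {K : Fin n → Fin n → ℝ} (hK : ∀ i j, K i j = K j i) :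
    2 * sumPairs K = ∑ i, ∑ j, K i j - ∑ i, K i i := by
  have h1 : ∑ i, ∑ j, K i j = ∑ i, ∑ j, ((if i < j then K i j else 0)
      + (if j < i then K i j else 0) + (if j = i then K i j else 0)) := by
    refine Finset.sum_congr rfl fun i _ => Finset.sum_congr rfl fun j _ => ?_
    rcases lt_trichotomy i j with h | h | h
    · simp [h, h.not_gt, h.ne']
    · simp [h]
    · simp [h, h.not_gt, h.ne]
  have h2 : ∑ i, ∑ j, (if j < i then K i j else 0) = sumPairs K := by
    rw [Finset.sum_comm, sumPairs]
    simp only [Finset.sum_filter]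
    exact Finset.sum_congr rfl fun i _ => Finset.sum_congr rfl fun j _ => by rw [hK]
  have h3 : ∑ i, ∑ j, (if i < j then K i j else 0) = sumPairs K := by
    rw [sumPairs]
    simp only [Finset.sum_filter]
  simp only [Finset.sum_add_distrib, h2, h3] at h1
  simp at h1
  linarith

theorem sumPairs_const (n : ℕ) (c : ℝ) :
    sumPairs (fun _ _ : Fin n => c) = c * ((n : ℝ) * (n - 1) / 2) := by
  have h := two_mul_sumPairs (n := n) (K := fun _ _ => c) fun _ _ => rfl
  simp at h
  linarith

/-- The bound `4 ≤ j` separates `(i, j)` from the distinguished pairs `(0, 1)` and `(2, 3)`, so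
three different nonnegative summands are involved. -/
theorem add_add_le_sumPairs (hn : 4 ≤ n) {K : Fin n → Fin n → ℝ} (hK : ∀ i j, 0 ≤ K i j)
    {i j : Fin n} (hij : i < j) (hj : 4 ≤ (j : ℕ)) :
    K (Fin.castLE hn 0) (Fin.castLE hn 1) + K (Fin.castLE hn 2) (Fin.castLE hn 3) + K i j
      ≤ sumPairs K := by
  rw [sumPairs_eq_sum_filter]
  have h1 : ((Fin.castLE hn 2, Fin.castLE hn 3) : Fin n × Fin n) ≠ (i, j) := by
    intro h
    have := congrArg (fun x : Fin n × Fin n => (x.2 : ℕ)) h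
    simp at this
    omega
  have h2 : ((Fin.castLE hn 0, Fin.castLE hn 1) : Fin n × Fin n)
      ∉ ({(Fin.castLE hn 2, Fin.castLE hn 3), (i, j)} : Finset (Fin n × Fin n)) := by
    intro h
    simp only [Finset.mem_insert, Finset.mem_singleton, Prod.mk.injEq, Fin.ext_iff] at h
    simp at h
    omega
  have h3 := Finset.sum_le_sum_of_subset_of_nonneg
    (s := {(Fin.castLE hn 0, Fin.castLE hn 1), (Fin.castLE hn 2, Fin.castLE hn 3), (i, j)})
    (t := (Finset.univ : Finset (Fin n × Fin n)).filter (fun x => x.1 < x.2))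
    (f := fun x => K x.1 x.2) (by
      intro x hx
      simp only [Finset.mem_insert, Finset.mem_singleton] at hx
      simp only [Finset.mem_filter, Finset.mem_univ, true_and]
      rcases hx with rfl | rfl | rfl
      · simp [Fin.lt_def]
      · simp [Fin.lt_def]
      · exact hij) (fun x _ _ => hK _ _)
  rw [Finset.sum_insert h2, Finset.sum_pair h1] at h3
  linarith

/-- The indices outside the two distinguished planes. -/
def restIndices (hn : 4 ≤ n) : Finset (Fin n) :=
  (((Finset.univ.erase (Fin.castLE hn 0)).erase (Fin.castLE hn 1)).erase
    (Fin.castLE hn 2)).erase (Fin.castLE hn 3)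

theorem sum_eq_add_sum_restIndices {A : Type*} [AddCommMonoid A] (hn : 4 ≤ n) (a : Fin n → A) :
    ∑ i, a i = a (Fin.castLE hn 0) + (a (Fin.castLE hn 1) + (a (Fin.castLE hn 2)
      + (a (Fin.castLE hn 3) + ∑ i ∈ restIndices hn, a i))) := by
  rw [restIndices, Finset.add_sum_erase, Finset.add_sum_erase, Finset.add_sum_erase,
    Finset.add_sum_erase] <;> simp [Fin.ext_iff]

theorem mem_restIndices (hn : 4 ≤ n) {i : Fin n} (hi : 4 ≤ (i : ℕ)) : i ∈ restIndices hn := by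
  simp only [restIndices, Finset.mem_erase, Finset.mem_univ, and_true, ne_eq, Fin.ext_iff]
  simp
  omega

variable {Q : V →ₗ[ℝ] V →ₗ[ℝ] ℝ} (hsymm : ∀ v w, Q v w = Q w v)

include hsymm in
-- Merging `a 0 + a 1` and `a 2 + a 3` leaves `n - 2` vectors with mean `s`, and the left side is
-- the sum of products over pairs of these blocks. It equals half of the square of the total minus
-- half the sum of the block squares, the latter being `(n - 2) Q s s` plus the squared deviations.
theorem sumPairs_trace (hn : 4 ≤ n) (a : Fin n → V) {s : V} (hs : ∑ i, a i = ((n : ℝ) - 2) • s) :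
    sumPairs (fun i j => Q (a i) (a j)) - Q (a (Fin.castLE hn 0)) (a (Fin.castLE hn 1))
        - Q (a (Fin.castLE hn 2)) (a (Fin.castLE hn 3))
      = ((n : ℝ) - 3) * (n - 2) / 2 * Q s s
        - 1 / 2 * (Q (a (Fin.castLE hn 0) + a (Fin.castLE hn 1) - s)
            (a (Fin.castLE hn 0) + a (Fin.castLE hn 1) - s)
          + Q (a (Fin.castLE hn 2) + a (Fin.castLE hn 3) - s)
            (a (Fin.castLE hn 2) + a (Fin.castLE hn 3) - s)
          + ∑ i ∈ restIndices hn, Q (a i - s) (a i - s)) := by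
  have h1 := two_mul_sumPairs (K := fun i j => Q (a i) (a j)) fun i j => hsymm _ _
  have h2 : ∑ i, ∑ j, Q (a i) (a j) = ((n : ℝ) - 2) ^ 2 * Q s s := by
    have : ∑ i, ∑ j, Q (a i) (a j) = Q (∑ i, a i) (∑ j, a j) := by
      simp only [map_sum, LinearMap.sum_apply]
      exact Finset.sum_comm
    rw [this, hs]
    simp
    ring
  have h3 := sum_eq_add_sum_restIndices hn a
  have h4 := sum_eq_add_sum_restIndices hn fun i => Q (a i) (a i)
  have h5 : ∑ i ∈ restIndices hn, Q (a i - s) (a i - s)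
      = ∑ i ∈ restIndices hn, Q (a i) (a i) - 2 * Q (∑ i ∈ restIndices hn, a i) s
        + ((n : ℝ) - 4) * Q s s := by
    have hc : ((restIndices hn).card : ℝ) = n - 4 := by
      have := sum_eq_add_sum_restIndices hn fun _ => (1 : ℝ)
      simp at this
      linarith
    rw [← hc, map_sum, LinearMap.sum_apply, Finset.mul_sum, ← nsmul_eq_mul, ← Finset.sum_const,
      ← Finset.sum_sub_distrib, ← Finset.sum_add_distrib]
    refine Finset.sum_congr rfl fun i _ => ?_
    simp only [map_sub, LinearMap.sub_apply, hsymm s (a i)]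
    ring
  have h6 : Q (∑ i ∈ restIndices hn, a i) s = ((n : ℝ) - 2) * Q s s
      - Q (a (Fin.castLE hn 0)) s - Q (a (Fin.castLE hn 1)) s - Q (a (Fin.castLE hn 2)) s
      - Q (a (Fin.castLE hn 3)) s := by
    have := congrArg (fun v => Q v s) (hs.symm.trans h3)
    simp only [map_add, LinearMap.add_apply, map_smul, LinearMap.smul_apply, smul_eq_mul] at this
    linarith
  rw [h5, h6]
  simp only [map_sub, map_add, LinearMap.sub_apply, LinearMap.add_apply]
  simp only [hsymm s (a _), hsymm (a (Fin.castLE hn 1)) (a (Fin.castLE hn 0)),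
    hsymm (a (Fin.castLE hn 3)) (a (Fin.castLE hn 2))]
  rw [h2, h4] at h1
  linarith

variable (hpos : ∀ v, v ≠ 0 → 0 < Q v v)

include hpos in
theorem nonneg_of_pos (v : V) : 0 ≤ Q v v := by
  by_cases h : v = 0
  · simp [h]
  · exact (hpos v h).le

include hpos in
theorem eq_zero_of_le (v : V) (h : Q v v ≤ 0) : v = 0 := by
  by_contra hv
  exact absurd (hpos v hv) (not_lt.2 h)

include hsymm hpos in
/-- The inequality behind the Chen inequality, with a bound for the defect. -/
theorem chen_defect (hn : 4 ≤ n) (σ : Fin n → Fin n → V) {s : V}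
    (hs : ∑ i, σ i i = ((n : ℝ) - 2) • s) {i j k : Fin n} (hij : i < j) (hj : 4 ≤ (j : ℕ))
    (hk : 4 ≤ (k : ℕ)) :
    Q (σ i j) (σ i j) + 1 / 2 * Q (σ k k - s) (σ k k - s)
      ≤ sumPairs (fun i j => Q (σ i j) (σ i j) - Q (σ i i) (σ j j))
        - (Q (σ (Fin.castLE hn 0) (Fin.castLE hn 1)) (σ (Fin.castLE hn 0) (Fin.castLE hn 1))
          - Q (σ (Fin.castLE hn 0) (Fin.castLE hn 0)) (σ (Fin.castLE hn 1) (Fin.castLE hn 1)))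
        - (Q (σ (Fin.castLE hn 2) (Fin.castLE hn 3)) (σ (Fin.castLE hn 2) (Fin.castLE hn 3))
          - Q (σ (Fin.castLE hn 2) (Fin.castLE hn 2)) (σ (Fin.castLE hn 3) (Fin.castLE hn 3)))
        + ((n : ℝ) - 3) * (n - 2) / 2 * Q s s := by
  have hQ := nonneg_of_pos hpos
  have h1 := sumPairs_trace hsymm hn (fun i => σ i i) hs
  have h2 := add_add_le_sumPairs hn (K := fun i j => Q (σ i j) (σ i j)) (fun _ _ => hQ _) hij hj
  have h3 := Finset.single_le_sum (s := restIndices hn)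
    (f := fun i => Q (σ i i - s) (σ i i - s)) (fun _ _ => hQ _) (mem_restIndices hn hk)
  have h4 := sumPairs_add (fun i j => Q (σ i j) (σ i j)) fun i j => -1 * Q (σ i i) (σ j j)
  rw [sumPairs_mul] at h4
  have h5 : sumPairs (fun i j => Q (σ i j) (σ i j) - Q (σ i i) (σ j j))
      = sumPairs (fun i j => Q (σ i j) (σ i j) + -1 * Q (σ i i) (σ j j)) :=
    sumPairs_congr fun i j _ => by ring
  rw [h5, h4]
  -- The deviations of the two merged blocks are only needed to be nonnegative.
  have h6 := hQ (σ (Fin.castLE hn 0) (Fin.castLE hn 0) + σ (Fin.castLE hn 1) (Fin.castLE hn 1) - s)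
  have h7 := hQ (σ (Fin.castLE hn 2) (Fin.castLE hn 2) + σ (Fin.castLE hn 3) (Fin.castLE hn 3) - s)
  linarith

include hsymm hpos in
/-- The equality case of the Chen inequality. -/
theorem chen_rigidity (hn : 4 ≤ n) (σ σ' : Fin n → Fin n → V) {s s' : V}
    (hs : ∑ i, σ i i = ((n : ℝ) - 2) • s) (hs' : ∑ i, σ' i i = ((n : ℝ) - 2) • s')
    {k : Fin n → Fin n → ℝ} (hk : ∀ i j, k i j
      = 1 / 2 * (Q (σ i j) (σ i j) - Q (σ i i) (σ j j))
        + 1 / 2 * (Q (σ' i j) (σ' i j) - Q (σ' i i) (σ' j j)))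
    (h : sumPairs k - k (Fin.castLE hn 0) (Fin.castLE hn 1)
        - k (Fin.castLE hn 2) (Fin.castLE hn 3)
      = -(((n : ℝ) - 3) * (n - 2) / 4 * (Q s s + Q s' s')))
    {i j l : Fin n} (hij : i < j) (hj : 4 ≤ (j : ℕ)) (hl : 4 ≤ (l : ℕ)) :
    σ i j = 0 ∧ σ' i j = 0 ∧ σ l l = s ∧ σ' l l = s' := by
  have hQ := nonneg_of_pos hpos
  have h1 := chen_defect hsymm hpos hn σ hs hij hj hl
  have h2 := chen_defect hsymm hpos hn σ' hs' hij hj hl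
  rw [sumPairs_congr (L := fun i j => 1 / 2 * (Q (σ i j) (σ i j) - Q (σ i i) (σ j j))
        + 1 / 2 * (Q (σ' i j) (σ' i j) - Q (σ' i i) (σ' j j))) fun i j _ => hk i j,
    sumPairs_add, sumPairs_mul, sumPairs_mul, hk, hk] at h
  -- By `h` the defects bounded below in `h1` and `h2` have sum zero, so each of these four squares
  -- vanishes.
  have g1 := hQ (σ i j)
  have g2 := hQ (σ' i j)
  have g3 := hQ (σ l l - s)
  have g4 := hQ (σ' l l - s')
  refine ⟨eq_zero_of_le hpos _ ?_, eq_zero_of_le hpos _ ?_, sub_eq_zero.1 (eq_zero_of_le hpos _ ?_),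
    sub_eq_zero.1 (eq_zero_of_le hpos _ ?_)⟩ <;> linarith

theorem apply_linearCombination_of_orthonormal {b : Fin n → V}
    (hb : ∀ i j, Q (b i) (b j) = if i = j then 1 else 0) (x : Fin n → ℝ) (j : Fin n) :
    Q (Fintype.linearCombination ℝ b x) (b j) = x j := by
  simp [Fintype.linearCombination_apply, map_sum, LinearMap.sum_apply, hb]

theorem eq_sum_of_orthonormal [FiniteDimensional ℝ V] {b : Fin n → V}
    (hb : ∀ i j, Q (b i) (b j) = if i = j then 1 else 0) (hd : Module.finrank ℝ V = n) (v : V) :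
    v = ∑ i, Q v (b i) • b i := by
  have hinj : Function.Injective (Fintype.linearCombination ℝ b) := by
    rw [← LinearMap.ker_eq_bot, LinearMap.ker_eq_bot']
    intro x hx
    funext j
    rw [← apply_linearCombination_of_orthonormal hb x j, hx]
    simp
  obtain ⟨x, rfl⟩ := (LinearMap.injective_iff_surjective_of_finrank_eq_finrank
    (by simp [hd])).1 hinj v
  simp only [apply_linearCombination_of_orthonormal hb]
  exact Fintype.linearCombination_apply ℝ b x

include hsymm in
/-- The trace of a bilinear map does not depend on the orthonormal frame. -/
theorem sum_orthonormal_eq [FiniteDimensional ℝ V] {W : Type*} [AddCommGroup W] [Module ℝ W]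
    {b b' : Fin n → V} (hb : ∀ i j, Q (b i) (b j) = if i = j then 1 else 0)
    (hb' : ∀ i j, Q (b' i) (b' j) = if i = j then 1 else 0) (hd : Module.finrank ℝ V = n)
    (B : V →ₗ[ℝ] V →ₗ[ℝ] W) : ∑ i, B (b' i) (b' i) = ∑ i, B (b i) (b i) := by
  have h1 : ∀ i, B (b' i) (b' i) = ∑ j, Q (b' i) (b j) • B (b' i) (b j) := fun i => by
    conv_lhs => rw [eq_sum_of_orthonormal hb hd (b' i)]
    rw [map_sum]
    refine Finset.sum_congr rfl fun j _ => ?_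
    rw [map_smul]
    congr 2
    exact congrArg _ (eq_sum_of_orthonormal hb hd (b' i)).symm
  have h2 : ∀ j, B (b j) (b j) = ∑ i, Q (b' i) (b j) • B (b' i) (b j) := fun j => by
    conv_lhs => rw [show B (b j) = B (∑ i, Q (b j) (b' i) • b' i) from
      congrArg _ (eq_sum_of_orthonormal hb' hd (b j))]
    rw [map_sum, LinearMap.sum_apply]
    refine Finset.sum_congr rfl fun i _ => ?_
    rw [map_smul, LinearMap.smul_apply, hsymm]
  simp only [h1, h2]
  exact Finset.sum_comm

/-! ### Quaternionic decomposition along a Lagrangian subspace. -/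

section Lagrangian

variable {b : Fin n → V} {J : Fin 3 → V →ₗ[ℝ] V}

/-- The linear combinations of the vectors `b i` and `J α (b i)`. -/
def quaternionicCombination (b : Fin n → V) (J : Fin 3 → V →ₗ[ℝ] V) :
    (Fin 4 → Fin n → ℝ) →ₗ[ℝ] V :=
  Fintype.linearCombination ℝ b ∘ₗ LinearMap.proj 0
    + ∑ α : Fin 3, J α ∘ₗ Fintype.linearCombination ℝ b ∘ₗ LinearMap.proj α.succ

theorem quaternionicCombination_apply (x : Fin 4 → Fin n → ℝ) :
    quaternionicCombination b J x = Fintype.linearCombination ℝ b (x 0)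
      + (J 0 (Fintype.linearCombination ℝ b (x 1)) + J 1 (Fintype.linearCombination ℝ b (x 2))
        + J 2 (Fintype.linearCombination ℝ b (x 3))) := by
  simp [quaternionicCombination, Fin.sum_univ_three]

variable (hb : ∀ i j, Q (b i) (b j) = if i = j then 1 else 0)
  (hJ : ∀ α i j, Q (J α (b i)) (b j) = 0)
  (hsq : ∀ α v, J α (J α v) = -v) (hmul : ∀ α v, J α (J (α + 1) v) = J (α + 2) v)
  (hmul' : ∀ α v, J (α + 1) (J α v) = -J (α + 2) v)

include hJ in
theorem apply_J_linearCombination (α : Fin 3) (x : Fin n → ℝ) (j : Fin n) :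
    Q (J α (Fintype.linearCombination ℝ b x)) (b j) = 0 := by
  simp [Fintype.linearCombination_apply, map_sum, LinearMap.sum_apply, hJ]

include hb hJ in
theorem apply_quaternionicCombination (x : Fin 4 → Fin n → ℝ) (j : Fin n) :
    Q (quaternionicCombination b J x) (b j) = x 0 j := by
  simp only [quaternionicCombination_apply, map_add, LinearMap.add_apply,
    apply_linearCombination_of_orthonormal hb, apply_J_linearCombination hJ]
  simp

include hb hJ hsq hmul hmul' in
-- By the quaternion relations `J α` sends every summand into some `J β` of the span of `b`, which
-- is orthogonal to `b`, except the one with `J α` itself, where `J α² = -1`. The coefficients are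
-- thus recovered although the `J α` need not be isometric or skew for `Q`.
theorem apply_J_quaternionicCombination (x : Fin 4 → Fin n → ℝ) (α : Fin 3) (j : Fin n) :
    Q (J α (quaternionicCombination b J x)) (b j) = -x α.succ j := by
  have m01 := hmul 0
  have m12 := hmul 1
  have m20 := hmul 2
  have m10 := hmul' 0
  have m21 := hmul' 1
  have m02 := hmul' 2
  simp only [show (0 : Fin 3) + 1 = 1 from rfl, show (0 : Fin 3) + 2 = 2 from rfl,
    show (1 : Fin 3) + 1 = 2 from rfl, show (1 : Fin 3) + 2 = 0 from rfl,
    show (2 : Fin 3) + 1 = 0 from rfl, show (2 : Fin 3) + 2 = 1 from rfl]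
    at m01 m12 m20 m10 m21 m02
  fin_cases α <;>
  simp [quaternionicCombination_apply, hsq, m01, m12, m20, m10, m21, m02,
    apply_linearCombination_of_orthonormal hb, apply_J_linearCombination hJ]

include hb hJ hsq hmul hmul' in
theorem quaternionicCombination_surjective [FiniteDimensional ℝ V]
    (hd : Module.finrank ℝ V = 4 * n) : Function.Surjective (quaternionicCombination b J) := by
  refine (LinearMap.injective_iff_surjective_of_finrank_eq_finrank ?_).1 ?_
  · rw [hd, Module.finrank_pi_fintype]
    simp
  · rw [← LinearMap.ker_eq_bot, LinearMap.ker_eq_bot']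
    intro x hx
    funext α j
    refine Fin.cases ?_ (fun α => ?_) α
    · rw [← apply_quaternionicCombination hb hJ x j, hx]
      simp
    · have := apply_J_quaternionicCombination hb hJ hsq hmul hmul' x α j
      rw [hx] at this
      simpa using this.symm

include hb hJ hsq hmul hmul' in
-- The conditions say that all quaternionic coefficients of `h` vanish. Without compatibility of `J`
-- and `Q` this differs from orthogonality to the vectors `J α (b i)`, treated in
-- `eq_zero_of_orthogonal_J`; `s` needs the former, `s'` the latter.
theorem eq_zero_of_J_orthogonal [FiniteDimensional ℝ V] (hd : Module.finrank ℝ V = 4 * n) {h : V}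
    (h0 : ∀ i, Q h (b i) = 0) (h1 : ∀ α i, Q (J α h) (b i) = 0) : h = 0 := by
  obtain ⟨x, rfl⟩ := quaternionicCombination_surjective hb hJ hsq hmul hmul' hd h
  have hx : x = 0 := by
    funext α j
    refine Fin.cases ?_ (fun α => ?_) α
    · rw [← apply_quaternionicCombination hb hJ x j, h0]
      rfl
    · have := apply_J_quaternionicCombination hb hJ hsq hmul hmul' x α j
      rw [h1] at this
      simpa using this.symm
  rw [hx, map_zero]

include hb hJ hsq hmul hmul' hpos in
theorem eq_zero_of_orthogonal_J [FiniteDimensional ℝ V] (hd : Module.finrank ℝ V = 4 * n) {h : V}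
    (h0 : ∀ i, Q h (b i) = 0) (h1 : ∀ α i, Q h (J α (b i)) = 0) : h = 0 := by
  obtain ⟨x, hx⟩ := quaternionicCombination_surjective hb hJ hsq hmul hmul' hd h
  refine eq_zero_of_le hpos h (le_of_eq ?_)
  conv_lhs => rw [show Q h h = Q h (quaternionicCombination b J x) by rw [hx]]
  simp [quaternionicCombination_apply, Fintype.linearCombination_apply, map_sum, h0, h1]

include hsymm hpos hb hJ hsq hmul hmul' in
/-- The algebraic form of the theorem: in the equality case of the Chen inequality, the traces of
the two second fundamental forms of a Lagrangian subspace vanish. -/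
theorem trace_eq_zero_of_chen_equality [FiniteDimensional ℝ V] (hn : 6 ≤ n)
    (hd : Module.finrank ℝ V = 4 * n) {σ σ' : Fin n → Fin n → V}
    (hσ : ∀ i j, σ i j = σ j i) (hσ' : ∀ i j, σ' i j = σ' j i)
    (ht : ∀ i j k, Q (σ i j) (b k) = 0) (ht' : ∀ i j k, Q (σ' i j) (b k) = 0)
    (hrel : ∀ α i j k, Q (J α (σ i j)) (b k) + Q (J α (b j)) (σ' i k) = 0)
    {s s' : V}
    (hs : ∑ i, σ i i = ((n : ℝ) - 2) • s) (hs' : ∑ i, σ' i i = ((n : ℝ) - 2) • s')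
    {k : Fin n → Fin n → ℝ} (hk : ∀ i j, k i j
      = 1 / 2 * (Q (σ i j) (σ i j) - Q (σ i i) (σ j j))
        + 1 / 2 * (Q (σ' i j) (σ' i j) - Q (σ' i i) (σ' j j)))
    (h : sumPairs k - k (Fin.castLE (by omega : 4 ≤ n) 0) (Fin.castLE (by omega : 4 ≤ n) 1)
        - k (Fin.castLE (by omega : 4 ≤ n) 2) (Fin.castLE (by omega : 4 ≤ n) 3)
      = -(((n : ℝ) - 3) * (n - 2) / 4 * (Q s s + Q s' s'))) :
    ∑ i, σ i i = 0 ∧ ∑ i, σ' i i = 0 := by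
  have hrig : ∀ {i j l : Fin n}, i < j → 4 ≤ (j : ℕ) → 4 ≤ (l : ℕ) → _ :=
    fun hij hj hl => chen_rigidity hsymm hpos (by omega) σ σ' hs hs' hk h hij hj hl
  have key : ∀ α j, Q (J α s) (b j) = 0 ∧ Q s (b j) = 0 ∧ Q s' (J α (b j)) = 0
      ∧ Q s' (b j) = 0 := by
    intro α j
    -- This is where `6 ≤ n` matters: two indices, 4 and 5, lie outside the distinguished planes,
    -- and one of them differs from `j`.
    obtain ⟨i, hi, hij⟩ : ∃ i : Fin n, 4 ≤ (i : ℕ) ∧ i ≠ j := by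
      by_cases hj : (j : ℕ) = 4
      · exact ⟨⟨5, by omega⟩, by simp, fun h => by simp [← h] at hj⟩
      · exact ⟨⟨4, by omega⟩, by simp, fun h => by simp [← h] at hj⟩
    have h0 : σ i j = 0 ∧ σ' i j = 0 ∧ σ i i = s ∧ σ' i i = s' := by
      rcases lt_or_gt_of_ne hij with hlt | hlt
      · exact hrig hlt (hi.trans hlt.le) hi
      · rw [hσ i j, hσ' i j]
        exact hrig hlt hi hi
    obtain ⟨h1, h2, rfl, rfl⟩ := h0
    -- With `σ i i = s` and `σ' i j = 0` the relation loses its second term; in `r2`, with `σ i j =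
    -- 0` and `σ' i i = s'`, it loses its first.
    have r1 := hrel α i i j
    have r2 := hrel α i j i
    rw [h2, map_zero, add_zero] at r1
    rw [h1, map_zero, map_zero, LinearMap.zero_apply, zero_add] at r2
    exact ⟨r1, ht _ _ _, by rw [hsymm, r2], ht' _ _ _⟩
  rw [hs, hs', eq_zero_of_J_orthogonal hb hJ hsq hmul hmul' hd (fun i => (key 0 i).2.1)
      fun α i => (key α i).1, eq_zero_of_orthogonal_J hpos hb hJ hsq hmul hmul' hd
      (fun i => (key 0 i).2.2.2) fun α i => (key α i).2.2.1]
  simp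

end Lagrangian

end Algebra

/-! ### The Chen equality and minimality. -/

section Chen

set_option maxSynthPendingDepth 3

variable {E : Type*} [NormedAddCommGroup E] [NormedSpace ℝ E] [FiniteDimensional ℝ E]
  [CompleteSpace E]
  {M : Type*} [TopologicalSpace M] [ChartedSpace E M] [IsManifold 𝓘(ℝ, E) ∞ M]
  {E' : Type*} [NormedAddCommGroup E'] [NormedSpace ℝ E'] [FiniteDimensional ℝ E']
  [CompleteSpace E']
  {N : Type*} [TopologicalSpace N] [ChartedSpace E' N] [IsManifold 𝓘(ℝ, E') ∞ N]
  {S : StatisticalStructure 𝓘(ℝ, E) M} {T : StatisticalStructure 𝓘(ℝ, E') N} {f : M → N}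

/-- The metric at a point as a bilinear form. -/
def StatisticalStructure.form (S : StatisticalStructure 𝓘(ℝ, E) M) (p : M) :
    TangentSpace 𝓘(ℝ, E) p →ₗ[ℝ] TangentSpace 𝓘(ℝ, E) p →ₗ[ℝ] ℝ :=
  LinearMap.mk₂ ℝ (fun v w => S.g.inner p v w) (by simp) (by simp) (by simp) (by simp)

@[simp]
theorem StatisticalStructure.form_apply (p : M) (v w : TangentSpace 𝓘(ℝ, E) p) :
    S.form p v w = S.g.inner p v w := rfl

/-- The second fundamental form as a bilinear map. -/
def secondFormBilin (D : CovariantDerivative 𝓘(ℝ, E) E (TangentSpace 𝓘(ℝ, E) : M → Type _))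
    (D' : CovariantDerivative 𝓘(ℝ, E') E' (TangentSpace 𝓘(ℝ, E') : N → Type _))
    {f : M → N} (hf : ContMDiff 𝓘(ℝ, E) 𝓘(ℝ, E') ∞ f) (p : M) :
    TangentSpace 𝓘(ℝ, E) p →ₗ[ℝ] TangentSpace 𝓘(ℝ, E) p →ₗ[ℝ] TangentSpace 𝓘(ℝ, E') (f p) :=
  LinearMap.mk₂ ℝ (secondForm D.toFun D'.toFun f p)
    (fun u v w => toChart_injective (mem_chart_source E' (f p)) (by
      simp only [map_add, toChart_secondForm D D' hf, chartSecondForm, add_apply]; abel))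
    (fun r u v => toChart_injective (mem_chart_source E' (f p)) (by
      simp only [map_smul, toChart_secondForm D D' hf, chartSecondForm, smul_apply]; module))
    (fun u v w => toChart_injective (mem_chart_source E' (f p)) (by
      simp only [map_add, toChart_secondForm D D' hf, chartSecondForm, add_apply]; abel))
    (fun r u v => toChart_injective (mem_chart_source E' (f p)) (by
      simp only [map_smul, toChart_secondForm D D' hf, chartSecondForm, smul_apply]; module))

omit [CompleteSpace E'] in
/-- The sum `∑ σ(e_i, e_i)` does not depend on the orthonormal frame. -/
theorem sum_secondForm_eq (D : CovariantDerivative 𝓘(ℝ, E) E (TangentSpace 𝓘(ℝ, E) : M → Type _))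
    (D' : CovariantDerivative 𝓘(ℝ, E') E' (TangentSpace 𝓘(ℝ, E') : N → Type _))
    (hf : ContMDiff 𝓘(ℝ, E) 𝓘(ℝ, E') ∞ f) {p : M} {n : ℕ} (hd : Module.finrank ℝ E = n)
    {e e' : Fin n → TangentSpace 𝓘(ℝ, E) p} (he : S.IsOrthonormalFrame p e)
    (he' : S.IsOrthonormalFrame p e') :
    ∑ i, secondForm D.toFun D'.toFun f p (e' i) (e' i)
      = ∑ i, secondForm D.toFun D'.toFun f p (e i) (e i) := by
  have : FiniteDimensional ℝ (TangentSpace 𝓘(ℝ, E) p) := inferInstanceAs (FiniteDimensional ℝ E)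
  exact sum_orthonormal_eq (Q := S.form p) (S.g.symm p) he he' hd (secondFormBilin D D' hf p)

variable {Λ : Π x : N, Submodule ℝ (TangentSpace 𝓘(ℝ, E') x →L[ℝ] TangentSpace 𝓘(ℝ, E') x)}
  {c : ℝ}

/-- Along a totally real submanifold, the ambient curvature is that of a space form. -/
theorem IsTotallyReal.inner_curvature (hr : IsTotallyReal (I := 𝓘(ℝ, E)) T Λ f)
    (hN : IsQuaternionKaehlerLike T Λ c) (hf : IsStatisticalSubmanifold S T f) (p : M)
    (u v w z : TangentSpace 𝓘(ℝ, E) p) :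
    T.g.inner (f p) (curvature T.conn.toFun (f p) (mfderiv 𝓘(ℝ, E) 𝓘(ℝ, E') f p u)
        (mfderiv 𝓘(ℝ, E) 𝓘(ℝ, E') f p v) (mfderiv 𝓘(ℝ, E) 𝓘(ℝ, E') f p w))
        (mfderiv 𝓘(ℝ, E) 𝓘(ℝ, E') f p z)
      = c / 4 * (S.g.inner p v w * S.g.inner p u z - S.g.inner p u w * S.g.inner p v z) := by
  obtain ⟨U, J, hp, hJ⟩ := hN.exists_basis (f p)
  have h1 : ∀ α (u v : TangentSpace 𝓘(ℝ, E) p), T.g.inner (f p)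
      (J α (f p) (mfderiv 𝓘(ℝ, E) 𝓘(ℝ, E') f p u)) (mfderiv 𝓘(ℝ, E) 𝓘(ℝ, E') f p v) = 0 :=
    fun α => hr p _ (by
      rw [← hJ.span _ hp]
      exact Submodule.subset_span ⟨α, rfl⟩)
  have h2 : ∀ α (u v : TangentSpace 𝓘(ℝ, E) p), T.g.inner (f p)
      (mfderiv 𝓘(ℝ, E) 𝓘(ℝ, E') f p u) (J α (f p) (mfderiv 𝓘(ℝ, E) 𝓘(ℝ, E') f p v)) = 0 :=
    fun α u v => by rw [T.g.symm, h1]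
  rw [hN.curvature_eq U J hJ _ hp]
  simp only [h1, h2, zero_smul, sub_zero, Finset.sum_const_zero, add_zero, map_smul, map_sub,
    smul_apply, sub_apply, smul_eq_mul, ← hf.isometric]

/-- The contribution of a tangent plane to the Chen inequality. -/
theorem IsTotallyReal.sectional_eq (hr : IsTotallyReal (I := 𝓘(ℝ, E)) T Λ f)
    (hN : IsQuaternionKaehlerLike T Λ c) (hf : IsStatisticalSubmanifold S T f) (p : M)
    {u v : TangentSpace 𝓘(ℝ, E) p} (hu : S.g.inner p u u = 1) (hv : S.g.inner p v v = 1)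
    (huv : S.g.inner p u v = 0) :
    S.sectionalK p u v - S.sectionalLC p u v
        + 2 * T.sectionalLC (f p) (mfderiv 𝓘(ℝ, E) 𝓘(ℝ, E') f p u)
          (mfderiv 𝓘(ℝ, E) 𝓘(ℝ, E') f p v)
      = c / 4 + (1 / 2 * (T.form (f p) (secondForm S.conn.toFun T.conn.toFun f p u v)
            (secondForm S.conn.toFun T.conn.toFun f p u v)
          - T.form (f p) (secondForm S.conn.toFun T.conn.toFun f p u u)
            (secondForm S.conn.toFun T.conn.toFun f p v v))
        + 1 / 2 * (T.form (f p) (secondForm S.dual.toFun T.dual.toFun f p u v)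
            (secondForm S.dual.toFun T.dual.toFun f p u v)
          - T.form (f p) (secondForm S.dual.toFun T.dual.toFun f p u u)
            (secondForm S.dual.toFun T.dual.toFun f p v v))) := by
  have g1 := hf.gauss p u v v u
  have g2 := hf.swap.gauss p u v v u
  have g3 := hf.riemannian.gauss p u v v u
  have c1 := hr.inner_curvature hN hf p u v v u
  -- The curvature formula is assumed only for the ambient connection; `c2` and the duality `c3`
  -- give the value `c/4` for the dual one.
  have c2 := hr.inner_curvature hN hf p u v u v
  have c3 := T.inner_curvature_dual (f p) (mfderiv 𝓘(ℝ, E) 𝓘(ℝ, E') f p u)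
    (mfderiv 𝓘(ℝ, E) 𝓘(ℝ, E') f p v) (mfderiv 𝓘(ℝ, E) 𝓘(ℝ, E') f p u)
    (mfderiv 𝓘(ℝ, E) 𝓘(ℝ, E') f p v)
  have s1 := hf.secondForm_symm p v u
  have s2 := hf.swap.secondForm_symm p v u
  have hvu : S.g.inner p v u = 0 := by rw [S.g.symm, huv]
  rw [hu, hv, huv, hvu] at c1 c2
  rw [T.g.symm (f p) (mfderiv 𝓘(ℝ, E) 𝓘(ℝ, E') f p u)] at c3
  simp only [StatisticalStructure.swap, StatisticalStructure.riemannian,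
    StatisticalStructure.leviCivitaConn, secondForm_leviCivita] at g2 g3 s2
  simp only [StatisticalStructure.sectionalK, StatisticalStructure.sectionalLC,
    StatisticalStructure.form_apply]
  rw [s2] at g1
  rw [s1] at g2
  rw [s1, s2] at g3
  -- Once `σ°` is expanded, the mixed products in `-2 * g3` cancel those in half the sum of `g1` and
  -- `g2`.
  simp only [map_smul, map_add, smul_apply, add_apply, smul_eq_mul] at g3
  have t1 := T.g.symm (f p) (secondForm S.conn.toFun T.conn.toFun f p v v)
    (secondForm S.conn.toFun T.conn.toFun f p u u)
  have t2 := T.g.symm (f p) (secondForm S.dual.toFun T.dual.toFun f p v v)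
    (secondForm S.dual.toFun T.dual.toFun f p u u)
  have t3 := T.g.symm (f p) (secondForm S.conn.toFun T.conn.toFun f p u v)
    (secondForm S.dual.toFun T.dual.toFun f p u v)
  linarith

/-- The Chen equality in terms of the second fundamental forms. -/
theorem sumPairs_of_chen_equality {V : Type*} [AddCommGroup V] [Module ℝ V] {Q : V →ₗ[ℝ] V →ₗ[ℝ] ℝ} {n : ℕ}
    (hn : 6 ≤ n) {K₁ K₂ K₃ k : Fin n → Fin n → ℝ} {c : ℝ}
    (hk : ∀ i j, i < j → K₁ i j - K₂ i j + 2 * K₃ i j = c / 4 + k i j) {v v' : V}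
    {i₁ i₂ i₃ i₄ : Fin n}
    (h₁₂ : i₁ < i₂) (h₃₄ : i₃ < i₄)
    (h : (sumPairs K₁ - K₁ i₁ i₂ - K₁ i₃ i₄) - (sumPairs K₂ - K₂ i₁ i₂ - K₂ i₃ i₄)
      = c / 8 * ((n : ℝ) ^ 2 - n - 4)
        - (n : ℝ) ^ 2 * ((n : ℝ) - 3) / (4 * ((n : ℝ) - 2))
          * (Q ((1 / n : ℝ) • v) ((1 / n : ℝ) • v) + Q ((1 / n : ℝ) • v') ((1 / n : ℝ) • v'))
        - 2 * (sumPairs K₃ - K₃ i₁ i₂ - K₃ i₃ i₄)) :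
    sumPairs k - k i₁ i₂ - k i₃ i₄ = -(((n : ℝ) - 3) * (n - 2) / 4
      * (Q (((n : ℝ) - 2)⁻¹ • v) (((n : ℝ) - 2)⁻¹ • v)
        + Q (((n : ℝ) - 2)⁻¹ • v') (((n : ℝ) - 2)⁻¹ • v'))) := by
  have h6 : (6 : ℝ) ≤ n := by exact_mod_cast hn
  have h0 : (n : ℝ) ≠ 0 := by linarith
  have h2 : (n : ℝ) - 2 ≠ 0 := by linarith
  -- There are `n(n-1)/2` pairs; removing the two distinguished ones leaves `c/4 * (n(n-1)/2 - 2)`,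
  -- the constant `c/8 * (n² - n - 4)` of the equality.
  have hs : sumPairs K₁ + -1 * sumPairs K₂ + 2 * sumPairs K₃
      = c / 4 * ((n : ℝ) * (n - 1) / 2) + sumPairs k := by
    rw [← sumPairs_const, ← sumPairs_mul, ← sumPairs_mul, ← sumPairs_add, ← sumPairs_add,
      ← sumPairs_add]
    exact sumPairs_congr fun i j hij => by rw [← hk i j hij]; ring
  have e₁ := hk _ _ h₁₂
  have e₂ := hk _ _ h₃₄
  -- The trace `v` equals both `n H` and `(n-2) s`, which converts the coefficient of `‖H‖²` into
  -- that of `‖s‖²`.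
  have hq : (n : ℝ) ^ 2 * ((n : ℝ) - 3) / (4 * ((n : ℝ) - 2))
          * (Q ((1 / n : ℝ) • v) ((1 / n : ℝ) • v) + Q ((1 / n : ℝ) • v') ((1 / n : ℝ) • v'))
      = ((n : ℝ) - 3) * (n - 2) / 4 * (Q (((n : ℝ) - 2)⁻¹ • v) (((n : ℝ) - 2)⁻¹ • v)
        + Q (((n : ℝ) - 2)⁻¹ • v') (((n : ℝ) - 2)⁻¹ • v')) := by
    simp only [map_smul, LinearMap.smul_apply, smul_eq_mul]
    field_simp
  rw [hq] at h
  linarith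

/-- A totally real statistical submanifold of maximal dimension that attains equality in the Chen
`δ(2,2)` inequality is minimal. -/
theorem IsTotallyReal.isMinimal {n : ℕ} (hn : 6 ≤ n) (hd : Module.finrank ℝ E = n)
    (hd' : Module.finrank ℝ E' = 4 * n) (hr : IsTotallyReal (I := 𝓘(ℝ, E)) T Λ f)
    (hN : IsQuaternionKaehlerLike T Λ c) (hf : IsStatisticalSubmanifold S T f)
    (hE : SatisfiesChenEquality S T f n (by omega) c) : IsMinimal S T f n := by
  intro p e' he'
  obtain ⟨e, he, hC⟩ := hE p
  obtain ⟨U, J, hp, hJ⟩ := hN.exists_basis (f p)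
  have : FiniteDimensional ℝ (TangentSpace 𝓘(ℝ, E') (f p)) :=
    inferInstanceAs (FiniteDimensional ℝ E')
  have hn' : (n : ℝ) - 2 ≠ 0 := by
    have : (6 : ℝ) ≤ n := by exact_mod_cast hn
    linarith
  set σ : Fin n → Fin n → TangentSpace 𝓘(ℝ, E') (f p) :=
    fun i j => secondForm S.conn.toFun T.conn.toFun f p (e i) (e j) with hσ
  set σ' : Fin n → Fin n → TangentSpace 𝓘(ℝ, E') (f p) :=
    fun i j => secondForm S.dual.toFun T.dual.toFun f p (e i) (e j) with hσ'
  have key : ∑ i, σ i i = 0 ∧ ∑ i, σ' i i = 0 := by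
    refine trace_eq_zero_of_chen_equality (Q := T.form (f p)) (T.g.symm (f p)) (T.g.pos (f p))
      (b := fun i => mfderiv 𝓘(ℝ, E) 𝓘(ℝ, E') f p (e i)) (J := fun α => (J α (f p)).toLinearMap)
      (fun i j => (hf.isometric p _ _).symm.trans (he i j)) (fun α i j => hr p _ ?_ _ _)
      (hJ.sq _ hp) (hJ.mul_next _ hp) (hJ.next_mul _ hp) hn hd'
      (fun i j => hf.secondForm_symm p _ _) (fun i j => hf.swap.secondForm_symm p _ _)
      (fun i j k => hf.inner_secondForm_tangent p _ _ _)
      (fun i j k => hf.swap.inner_secondForm_tangent p _ _ _)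
      (fun α i j k => hr.inner_secondForm hN hf hJ hp α _ _ _)
      (s := ((n : ℝ) - 2)⁻¹ • ∑ i, σ i i) (s' := ((n : ℝ) - 2)⁻¹ • ∑ i, σ' i i)
      (smul_inv_smul₀ hn' _).symm (smul_inv_smul₀ hn' _).symm (fun i j => rfl) ?_
    · rw [← hJ.span _ hp]
      exact Submodule.subset_span ⟨α, rfl⟩
    · exact sumPairs_of_chen_equality hn (fun i j hij => hr.sectional_eq hN hf p
        ((he i i).trans (if_pos rfl)) ((he j j).trans (if_pos rfl))
        ((he i j).trans (if_neg (ne_of_lt hij)))) (by simp [Fin.lt_def])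
        (by simp [Fin.lt_def]) hC
  -- The equality provides one frame `e`, while minimality concerns every frame `e'`; the trace is
  -- the same for both.
  constructor
  · rw [meanCurvature, sum_secondForm_eq S.conn T.conn hf.contMDiff hd he he']
    exact smul_eq_zero_of_right _ key.1
  · rw [meanCurvatureDual, sum_secondForm_eq S.dual T.dual hf.contMDiff hd he he']
    exact smul_eq_zero_of_right _ key.2

end Chen

end StatGeom

end

theorem mainTheorem6 (m n : ℕ) (hn : 6 ≤ n) (c : ℝ)
    {N : Type*} [TopologicalSpace N] [T2Space N]
    [ChartedSpace (EuclideanSpace ℝ (Fin (4 * m))) N] [IsManifold (𝓡 (4 * m)) ∞ N]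
    {M : Type*} [TopologicalSpace M] [T2Space M]
    [ChartedSpace (EuclideanSpace ℝ (Fin n)) M] [IsManifold (𝓡 n) ∞ M]
    (T : StatGeom.StatisticalStructure (𝓡 (4 * m)) N)
    (Λ : Π x : N, Submodule ℝ (TangentSpace (𝓡 (4 * m)) x →L[ℝ] TangentSpace (𝓡 (4 * m)) x))
    (hN : StatGeom.IsQuaternionKaehlerLike T Λ c)
    (S : StatGeom.StatisticalStructure (𝓡 n) M) (f : M → N)
    (hf : StatGeom.IsStatisticalSubmanifold S T f)
    (hL : StatGeom.IsLagrangian n T Λ f)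
    (hE : StatGeom.SatisfiesChenEquality S T f n (by omega) c) :
    StatGeom.IsMinimal S T f n :=
  hL.1.isMinimal hn (by simp) (by simp [hL.2]) hN hf hE
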